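/- Let $n\ge 2$, let $\mathbb R^n_+=\{x=(x',x_n): x'\in\mathbb R^{n-1},\ x_n>0\}$, and let $[h^\infty(\mathbb R^n_+)]^n$ be the space of vector fields $u=(u_1,\dots,u_n)$ on $\mathbb R^n_+$ whose components are bounded and harmonic. Every such $u$ has boundary values in $[L^\infty(\partial\mathbb R^n_+)]^n$, namely $u(y',0)=\lim_{t\to0+}u(y',t)$ for almost every $y'\in\mathbb R^{n-1}$; put $\|u\|_{[L^\infty(\partial\mathbb R^n_+)]^n}=\operatorname{ess\,sup}_{y'\in\mathbb R^{n-1}}|u(y',0)|$, where $|\cdot|$ is the Euclidean norm. For every point $x\in\mathbb R^n_+$, the sharp coefficient $\mathcal D_n(x)$ in the inequality $$|\operatorname{div}u(x)|\le \mathcal D_n(x)\,\|u\|_{[L^\infty(\partial\mathbb R^n_+)]^n},\qquad u\in[h^\infty(\mathbb R^n_+)]^n,$$ that is, the least real number for which the inequality holds at the point $x$ for all $u\in[h^\infty(\mathbb R^n_+)]^n$, is $$\mathcal D_n(x)=\frac{D_n}{x_n},\qquad D_n=\frac{2\omega_{n-1}}{\omega_n}\int_0^{\pi/2}\bigl[1+n(n-2)\cos^2\vartheta\bigr]^{1/2}\sin^{n-2}\vartheta\,d\vartheta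 ,$$ where $\omega_k$ is the surface area of the unit sphere in $\mathbb R^k$ (so $\omega_1=2$). In particular, $D_2=1$ and $D_3=1+\frac{\sqrt3}{6}\ln(2+\sqrt3)$. -/

import Mathlib

open MeasureTheory Filter Topology

noncomputable section

namespace HalfSpaceDiv

/-- The open half-space `ℝⁿ₊ = {x = (x', xₙ) : xₙ > 0}` of `ℝⁿ`, with `n = m + 1`. -/
def halfSpace (m : ℕ) : Set (EuclideanSpace ℝ (Fin (m + 1))) :=
  {x | 0 < x (Fin.last m)}

/-- The point `(y', t)` of `ℝ^(m+1)` with `y' ∈ ℝ^m` and last coordinate `t`. -/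
def pt {m : ℕ} (y : EuclideanSpace ℝ (Fin m)) (t : ℝ) : EuclideanSpace ℝ (Fin (m + 1)) :=
  WithLp.toLp 2 (Fin.snoc (α := fun _ => ℝ) (fun i => y i) t)

/-- `u` belongs to `[h^∞(ℝⁿ₊)]ⁿ`: the components of the vector field `u` are harmonic in the
half-space and `u` is bounded there. Values of `u` outside the half-space are irrelevant. -/
structure MemHardy {m : ℕ}
    (u : EuclideanSpace ℝ (Fin (m + 1)) → EuclideanSpace ℝ (Fin (m + 1))) : Prop where
  harmonic : ∀ i, InnerProductSpace.HarmonicOnNhd (fun z => u z i) (halfSpace m)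
  bounded : ∃ M : ℝ, ∀ z ∈ halfSpace m, ‖u z‖ ≤ M

/-- `g` is the boundary function of `u` on `∂ℝⁿ₊ = ℝ^m × {0}`: for almost every `y'` (Lebesgue
measure on `ℝ^m`), `u` has the limit `g y'` along the normal to the boundary at `(y', 0)`. -/
def HasBoundaryValues {m : ℕ}
    (u : EuclideanSpace ℝ (Fin (m + 1)) → EuclideanSpace ℝ (Fin (m + 1)))
    (g : EuclideanSpace ℝ (Fin m) → EuclideanSpace ℝ (Fin (m + 1))) : Prop :=
  ∀ᵐ y : EuclideanSpace ℝ (Fin m), Tendsto (fun t : ℝ => u (pt y t)) (𝓝[>] 0) (𝓝 (g y))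

/-- The divergence `∑ i, ∂uᵢ/∂xᵢ` at `x`. -/
def divergence {n : ℕ} (u : EuclideanSpace ℝ (Fin n) → EuclideanSpace ℝ (Fin n))
    (x : EuclideanSpace ℝ (Fin n)) : ℝ :=
  ∑ i, fderiv ℝ (fun z => u z i) x (EuclideanSpace.single i 1)

/-- `ω_n`: the surface area of the unit sphere `S^(n-1)` of `ℝⁿ`. -/
def sphereArea (n : ℕ) : ℝ :=
  ((volume : Measure (EuclideanSpace ℝ (Fin n))).toSphere Set.univ).toReal

/-- `D_n = (2 ω_{n-1} / ω_n) ∫₀^{π/2} [1 + n (n - 2) cos² ϑ]^{1/2} sin^{n-2} ϑ dϑ`, for `n ≥ 2`. -/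
def divConst (n : ℕ) : ℝ :=
  2 * sphereArea (n - 1) / sphereArea n *
    ∫ θ in (0 : ℝ)..(Real.pi / 2),
      Real.sqrt (1 + (n : ℝ) * ((n : ℝ) - 2) * Real.cos θ ^ 2) * Real.sin θ ^ (n - 2)

end HalfSpaceDiv

end

/-!
Every bounded harmonic function on the half-space is the Poisson integral of a bounded boundary
function `g`, which is its normal limit almost everywhere. Differentiating under the integral sign,
the divergence at `x` of a bounded harmonic field with boundary field `g` is
`∫ ⟨∇P(x - (y, 0)), g(y)⟩ dy`, where `P(z) = (2 / ω_n) zₙ / |z|ⁿ` is the Poisson kernel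
(`divergence_poissonField`). Hence the best constant at `x` is `∫ |∇P(x - (y, 0))| dy`: this is an
upper bound by Cauchy–Schwarz (`abs_divergence_le`), and it is attained by the Poisson integral of
the boundary field `∇P / |∇P|`, which is continuous of norm one because `∇P` has no zeros for
`n ≥ 2` (`divConst_div_le`). Since `|∇P(z)| = (2 / ω_n) |z|⁻ⁿ √(1 + n (n - 2) zₙ² / |z|²)`, polar
coordinates in the boundary with radius `xₙ tan ϑ` give the constant (`integral_cos_norm`).

The analytic part is the representation theorem `exists_eq_poissonIntegral` and the boundary
behaviour `ae_tendsto_poissonIntegral`. For the former, a bounded harmonic function pushed down by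
`s > 0` extends continuously to the boundary, so it agrees with the Poisson integral of its values
at height `s`; uniqueness is a Phragmén–Lindelöf principle, proved with an explicit superharmonic
barrier (`nonpos_of_harmonicOnNhd`). As `s → 0` these boundary values have a weak limit by
Banach–Alaoglu in a weighted `L²` space, and the Poisson kernels are admissible test functions. For
the latter, the Poisson kernel is radially decreasing, so at Lebesgue points the layer cake formula
reduces the convergence to that of averages over balls (`lintegral_mul_radial_le`).
-/

noncomputable section

namespace HalfSpaceDiv

/-! ### Coordinates of the half-space -/

/-- The Euclidean space `ℝ^k`. -/
abbrev Euc (k : ℕ) := EuclideanSpace ℝ (Fin k)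

variable {m : ℕ}

/-- The orthogonal projection `x ↦ x'` onto the first `m` coordinates. -/
def base (x : Euc (m + 1)) : Euc m := WithLp.toLp 2 (fun i => x i.castSucc)

@[simp] lemma pt_last (y : Euc m) (t : ℝ) : pt y t (Fin.last m) = t := by simp [pt]

@[simp] lemma pt_castSucc (y : Euc m) (t : ℝ) (i : Fin m) : pt y t i.castSucc = y i := by
  simp [pt]

@[simp] lemma pt_base (x : Euc (m + 1)) : pt (base x) (x (Fin.last m)) = x := by
  ext i
  refine Fin.lastCases ?_ (fun i => ?_) i <;> simp [base]

@[simp] lemma base_pt (y : Euc m) (t : ℝ) : base (pt y t) = y := by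
  ext i
  simp [base]

lemma norm_pt_sq (y : Euc m) (t : ℝ) : ‖pt y t‖ ^ 2 = ‖y‖ ^ 2 + t ^ 2 := by
  simp [EuclideanSpace.norm_sq_eq, Fin.sum_univ_castSucc]

lemma pt_sub_pt (y z : Euc m) (s t : ℝ) : pt y s - pt z t = pt (y - z) (s - t) := by
  ext i
  refine Fin.lastCases ?_ (fun i => ?_) i <;> simp

lemma pt_add_pt (y z : Euc m) (s t : ℝ) : pt y s + pt z t = pt (y + z) (s + t) := by
  ext i
  refine Fin.lastCases ?_ (fun i => ?_) i <;> simp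

lemma smul_pt (c : ℝ) (y : Euc m) (t : ℝ) : c • pt y t = pt (c • y) (c * t) := by
  ext i
  refine Fin.lastCases ?_ (fun i => ?_) i <;> simp

lemma norm_pt_zero (y : Euc m) : ‖pt y 0‖ = ‖y‖ := by
  have := norm_pt_sq y 0
  rw [zero_pow two_ne_zero, add_zero] at this
  exact (sq_eq_sq₀ (norm_nonneg _) (norm_nonneg _)).1 this

lemma abs_last_le_norm (x : Euc (m + 1)) : |x (Fin.last m)| ≤ ‖x‖ := by
  simpa using PiLp.norm_apply_le x (Fin.last m)

lemma norm_le_norm_pt (y : Euc m) (t : ℝ) : ‖y‖ ≤ ‖pt y t‖ := by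
  have := norm_pt_sq y t
  nlinarith [norm_nonneg y, norm_nonneg (pt y t), sq_nonneg t]

@[fun_prop] lemma continuous_pt : Continuous fun p : Euc m × ℝ => pt p.1 p.2 := by
  refine (PiLp.continuous_toLp 2 _).comp (continuous_pi fun i => ?_)
  refine Fin.lastCases ?_ (fun i => ?_) i
  · simpa using continuous_snd
  · simp only [Fin.snoc_castSucc]
    fun_prop

lemma continuous_pt_left (t : ℝ) : Continuous fun y : Euc m => pt y t :=
  continuous_pt.comp (continuous_id.prodMk continuous_const)

lemma continuous_pt_right (y : Euc m) : Continuous fun t : ℝ => pt y t :=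
  continuous_pt.comp (continuous_const.prodMk continuous_id)

@[fun_prop] lemma continuous_base : Continuous (base (m := m)) := by
  refine (PiLp.continuous_toLp 2 _).comp (continuous_pi fun i => ?_)
  fun_prop

lemma isOpen_halfSpace : IsOpen (halfSpace m) :=
  isOpen_lt continuous_const (by fun_prop)

lemma pt_mem_halfSpace {y : Euc m} {t : ℝ} (ht : 0 < t) : pt y t ∈ halfSpace m := by
  simpa [halfSpace] using ht

lemma ne_zero_of_mem_halfSpace {z : Euc (m + 1)} (hz : z ∈ halfSpace m) : z ≠ 0 := by
  rintro rfl
  simp [halfSpace] at hz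

lemma sub_pt_zero_mem {x : Euc (m + 1)} (hx : x ∈ halfSpace m) (y : Euc m) :
    x - pt y 0 ∈ halfSpace m := by
  simpa [halfSpace] using hx

/-! ### Integrals of translates of a kernel over the boundary -/

variable {G : Type*} [NormedAddCommGroup G]

/-- `F` decays like `‖z‖^{-n}`, `n = m + 1`, in every horizontal slab `δ ≤ zₙ ≤ R`, so that its
boundary translates are dominated by an integrable function. -/
def SlabDecay (F : Euc (m + 1) → G) : Prop :=
  ∀ δ > 0, ∀ R : ℝ, ∃ C : ℝ, ∀ z : Euc (m + 1), δ ≤ z (Fin.last m) → z (Fin.last m) ≤ R →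
    ‖F z‖ ≤ C / ‖z‖ ^ (m + 1)

/-- The integrable majorant `(1 + |y|)^{-n}`, `n = m + 1`, on `ℝ^m`. -/
def weight (y : Euc m) : ℝ := ((1 + ‖y‖) ^ (m + 1))⁻¹

lemma weight_pos (y : Euc m) : 0 < weight y := by unfold weight; positivity

lemma continuous_weight : Continuous (weight (m := m)) := by
  unfold weight
  refine Continuous.inv₀ (by fun_prop) fun y => by positivity

lemma integrable_weight : Integrable (weight (m := m)) := by
  have h := integrable_one_add_norm (E := Euc m) (μ := volume) (r := (m : ℝ) + 1) (by simp)
  refine h.congr (ae_of_all _ fun y => ?_)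
  simp only [weight]
  rw [Real.rpow_neg (by positivity), ← Nat.cast_add_one, Real.rpow_natCast]

/-- Near a point of the half-space, the boundary translates of `F` are dominated by one multiple of
`weight`; this is the majorant for differentiation and continuity under the integral sign. -/
lemma SlabDecay.locally_le {F : Euc (m + 1) → G} (hF : SlabDecay F) {x₀ : Euc (m + 1)}
    (hx₀ : x₀ ∈ halfSpace m) :
    ∃ δ > 0, ∃ C : ℝ, Metric.ball x₀ δ ⊆ halfSpace m ∧
      ∀ x ∈ Metric.ball x₀ δ, ∀ y : Euc m, ‖F (x - pt y 0)‖ ≤ C * weight y := by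
  set a := x₀ (Fin.last m) with ha
  have ha0 : 0 < a := hx₀
  obtain ⟨C, hC⟩ := hF (a / 2) (by positivity) (2 * a)
  have key : ∀ x ∈ Metric.ball x₀ (a / 2), a / 2 ≤ x (Fin.last m) ∧ x (Fin.last m) ≤ 2 * a := by
    intro x hx
    have h1 := (abs_last_le_norm (x - x₀)).trans_lt (mem_ball_iff_norm.1 hx)
    rw [PiLp.sub_apply, abs_lt, ← ha] at h1
    constructor <;> linarith
  -- `c` is chosen so that `1 + ‖y‖ ≤ c ‖x - (y, 0)‖` for all `x` in the ball.
  set c := 1 + (1 + ‖x₀‖ + a / 2) / (a / 2) with hc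
  have hc0 : 0 < c := by positivity
  refine ⟨a / 2, by positivity, |C| * c ^ (m + 1), fun x hx => ?_, fun x hx y => ?_⟩
  · have := (key x hx).1
    exact lt_of_lt_of_le (by positivity) this
  · have hz := hC (x - pt y 0) (by simpa using (key x hx).1) (by simpa using (key x hx).2)
    have h2 : a / 2 ≤ ‖x - pt y 0‖ := by
      refine (key x hx).1.trans ?_
      have := (le_abs_self _).trans (abs_last_le_norm (x - pt y 0))
      simpa using this
    have hxn : ‖x‖ ≤ ‖x₀‖ + a / 2 := by
      have := norm_sub_norm_le x x₀
      have := mem_ball_iff_norm.1 hx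
      linarith
    have h3 : 1 + ‖y‖ ≤ c * ‖x - pt y 0‖ := by
      have h4 : ‖y‖ ≤ ‖x‖ + ‖x - pt y 0‖ := by
        rw [← norm_pt_zero y]
        calc ‖pt y 0‖ = ‖x - (x - pt y 0)‖ := by simp
          _ ≤ _ := norm_sub_le _ _
      have h5 : 1 + ‖x₀‖ + a / 2 ≤ (1 + ‖x₀‖ + a / 2) / (a / 2) * ‖x - pt y 0‖ := by
        rw [div_mul_eq_mul_div, le_div_iff₀ (by positivity)]
        gcongr
      rw [hc, add_mul, one_mul]
      linarith
    have hpos : 0 < ‖x - pt y 0‖ := lt_of_lt_of_le (by positivity) h2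
    refine hz.trans ?_
    rw [weight, ← div_eq_mul_inv, div_le_div_iff₀ (by positivity) (by positivity)]
    calc C * (1 + ‖y‖) ^ (m + 1) ≤ |C| * (c * ‖x - pt y 0‖) ^ (m + 1) := by
          gcongr
          exact le_abs_self C
      _ = _ := by rw [mul_pow]; ring

lemma continuous_translate {F : Euc (m + 1) → G} (hF : ContinuousOn F (halfSpace m))
    {x : Euc (m + 1)} (hx : x ∈ halfSpace m) : Continuous fun y : Euc m => F (x - pt y 0) := by
  refine hF.comp_continuous (continuous_const.sub (continuous_pt_left 0)) fun y =>
    sub_pt_zero_mem hx y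

section
variable [NormedSpace ℝ G] {F : Euc (m + 1) → G} {g : Euc m → ℝ} {M : ℝ}

lemma aestronglyMeasurable_translate (hFc : ContinuousOn F (halfSpace m))
    (hg : AEStronglyMeasurable g volume) {x : Euc (m + 1)} (hx : x ∈ halfSpace m) :
    AEStronglyMeasurable (fun y => g y • F (x - pt y 0)) volume :=
  hg.smul (continuous_translate hFc hx).aestronglyMeasurable

lemma norm_smul_translate_le {C : ℝ} {x : Euc (m + 1)} {y : Euc m} (hy : |g y| ≤ M)
    (h : ‖F (x - pt y 0)‖ ≤ C * weight y) :
    ‖g y • F (x - pt y 0)‖ ≤ M * C * weight y := by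
  rw [norm_smul, mul_assoc]
  exact mul_le_mul hy h (norm_nonneg _) ((abs_nonneg _).trans hy)

lemma integrable_translate (hF : SlabDecay F) (hFc : ContinuousOn F (halfSpace m))
    (hg : AEStronglyMeasurable g volume) (hM : ∀ᵐ y, |g y| ≤ M) {x : Euc (m + 1)}
    (hx : x ∈ halfSpace m) : Integrable (fun y => g y • F (x - pt y 0)) := by
  obtain ⟨δ, hδ, C, -, hC⟩ := hF.locally_le hx
  refine (integrable_weight.const_mul (M * C)).mono'
    (aestronglyMeasurable_translate hFc hg hx) ?_
  filter_upwards [hM] with y hy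
  exact norm_smul_translate_le hy (hC x (Metric.mem_ball_self hδ) y)

lemma continuousOn_integral_translate (hF : SlabDecay F) (hFc : ContinuousOn F (halfSpace m))
    (hg : AEStronglyMeasurable g volume) (hM : ∀ᵐ y, |g y| ≤ M) :
    ContinuousOn (fun x => ∫ y, g y • F (x - pt y 0)) (halfSpace m) := by
  intro x hx
  refine ContinuousAt.continuousWithinAt ?_
  obtain ⟨δ, hδ, C, hsub, hC⟩ := hF.locally_le hx
  have hb := Metric.ball_mem_nhds x hδ
  refine continuousAt_of_dominated (bound := fun y => M * C * weight y) ?_ ?_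
    (integrable_weight.const_mul (M * C)) ?_
  · filter_upwards [hb] with z hz
    exact aestronglyMeasurable_translate hFc hg (hsub hz)
  · filter_upwards [hb] with z hz
    filter_upwards [hM] with y hy
    exact norm_smul_translate_le hy (hC z hz y)
  · refine ae_of_all _ fun y => ContinuousAt.const_smul ?_ _
    have h1 : ContinuousAt F (x - pt y 0) :=
      hFc.continuousAt (isOpen_halfSpace.mem_nhds (sub_pt_zero_mem hx y))
    exact ContinuousAt.comp (f := fun z => z - pt y 0) h1
      (continuousAt_id.sub continuousAt_const)

lemma hasFDerivAt_integral_translate [CompleteSpace G] (hF : SlabDecay F)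
    (hFd : DifferentiableOn ℝ F (halfSpace m)) (hF' : SlabDecay (fderiv ℝ F))
    (hFc' : ContinuousOn (fderiv ℝ F) (halfSpace m))
    (hg : AEStronglyMeasurable g volume) (hM : ∀ᵐ y, |g y| ≤ M) {x : Euc (m + 1)}
    (hx : x ∈ halfSpace m) :
    HasFDerivAt (fun x => ∫ y, g y • F (x - pt y 0)) (∫ y, g y • fderiv ℝ F (x - pt y 0)) x := by
  obtain ⟨δ, hδ, C, hsub, hC⟩ := hF'.locally_le hx
  have hb := Metric.ball_mem_nhds x hδ
  refine hasFDerivAt_integral_of_dominated_of_fderiv_le (𝕜 := ℝ)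
    (F' := fun x y => g y • fderiv ℝ F (x - pt y 0))
    (bound := fun y => M * C * weight y) hb ?_ ?_ ?_ ?_
    (integrable_weight.const_mul (M * C)) ?_
  · filter_upwards [hb] with z hz
    exact aestronglyMeasurable_translate hFd.continuousOn hg (hsub hz)
  · exact integrable_translate hF hFd.continuousOn hg hM hx
  · exact aestronglyMeasurable_translate hFc' hg hx
  · filter_upwards [hM] with y hy z hz
    exact norm_smul_translate_le hy (hC z hz y)
  · refine ae_of_all _ fun y z hz => HasFDerivAt.const_smul ?_ _
    have h1 : HasFDerivAt F (fderiv ℝ F (z - pt y 0)) (z - pt y 0) :=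
      (hFd.differentiableAt (isOpen_halfSpace.mem_nhds (sub_pt_zero_mem (hsub hz) y))).hasFDerivAt
    have h2 := h1.comp z ((hasFDerivAt_id z).sub_const (pt y 0))
    rwa [ContinuousLinearMap.comp_id] at h2

end

/-! ### Second derivatives along lines -/

section Line
variable {E : Type*} [NormedAddCommGroup E] [NormedSpace ℝ E] {F : E → ℝ} {z e : E}

lemma hasDerivAt_line (z e : E) (t : ℝ) : HasDerivAt (fun t : ℝ => z + t • e) e t := by
  simpa using ((hasDerivAt_id t).smul_const e).const_add z

lemma eventually_hasDerivAt_comp_line (hF : ContDiffAt ℝ 2 F z) :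
    ∀ᶠ t in 𝓝 (0 : ℝ), HasDerivAt (fun t => F (z + t • e)) (fderiv ℝ F (z + t • e) e) t := by
  have h3 : ∀ᶠ w in 𝓝 z, DifferentiableAt ℝ F w :=
    (hF.eventually (by simp)).mono fun w hw => hw.differentiableAt (by norm_num)
  have h4 : Tendsto (fun t : ℝ => z + t • e) (𝓝 0) (𝓝 z) := by
    simpa using (hasDerivAt_line z e 0).continuousAt.tendsto
  filter_upwards [h4.eventually h3] with t hd
  exact HasFDerivAt.comp_hasDerivAt (l := F) (f := fun t : ℝ => z + t • e) t
    hd.hasFDerivAt (hasDerivAt_line z e t)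

lemma hasDerivAt_fderiv_comp_line (hF : ContDiffAt ℝ 2 F z) :
    HasDerivAt (fun t : ℝ => fderiv ℝ F (z + t • e) e) (fderiv ℝ (fderiv ℝ F) z e e) 0 := by
  have hD : DifferentiableAt ℝ (fderiv ℝ F) z :=
    (hF.fderiv_right (m := 1) (by norm_num)).differentiableAt (by norm_num)
  have h6 : HasFDerivAt (fderiv ℝ F) (fderiv ℝ (fderiv ℝ F) z) (z + (0 : ℝ) • e) := by
    simpa using hD.hasFDerivAt
  have h7 : HasDerivAt (fun t : ℝ => fderiv ℝ F (z + t • e)) (fderiv ℝ (fderiv ℝ F) z e) 0 :=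
    HasFDerivAt.comp_hasDerivAt (l := fderiv ℝ F) (f := fun t : ℝ => z + t • e) 0 h6
      (hasDerivAt_line z e 0)
  exact (ContinuousLinearMap.apply ℝ ℝ e).hasFDerivAt.comp_hasDerivAt 0 h7

/-- The second derivative of `F` in the direction `e` is the second derivative of the restriction
of `F` to the line through `z` in that direction. -/
lemma fderiv_fderiv_apply_eq (hF : ContDiffAt ℝ 2 F z) {φ : ℝ → ℝ} {a : ℝ}
    (h1 : ∀ᶠ t in 𝓝 (0 : ℝ), HasDerivAt (fun t => F (z + t • e)) (φ t) t)
    (h2 : HasDerivAt φ a 0) : fderiv ℝ (fderiv ℝ F) z e e = a := by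
  have hev : ∀ᶠ t in 𝓝 (0 : ℝ), φ t = fderiv ℝ F (z + t • e) e := by
    filter_upwards [h1, eventually_hasDerivAt_comp_line (e := e) hF] with t ht hd
    exact ht.unique hd
  exact ((hasDerivAt_fderiv_comp_line hF).congr_of_eventuallyEq hev).unique h2

end Line

open InnerProductSpace Laplacian in
lemma laplacian_eq_sum_fderiv (F : Euc (m + 1) → ℝ) (z : Euc (m + 1)) :
    (Δ F) z = ∑ i, fderiv ℝ (fderiv ℝ F) z (EuclideanSpace.single i 1)
      (EuclideanSpace.single i 1) := by
  rw [congrFun (laplacian_eq_iteratedFDeriv_orthonormalBasis F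
    (EuclideanSpace.basisFun (Fin (m + 1)) ℝ)) z]
  simp [iteratedFDeriv_two_apply]

/-- Second derivative test: at a local maximum the second derivative is not positive. -/
lemma nonpos_of_isLocalMax_of_hasDerivAt {f f' : ℝ → ℝ} {a : ℝ} (hmax : IsLocalMax f 0)
    (h1 : ∀ᶠ t in 𝓝 (0 : ℝ), HasDerivAt f (f' t) t) (h2 : HasDerivAt f' a 0) : a ≤ 0 := by
  by_contra! ha
  have hd : deriv f =ᶠ[𝓝 0] f' := h1.mono fun t ht => ht.deriv
  have hdd : deriv (deriv f) 0 = a := (h2.congr_of_eventuallyEq hd).deriv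
  have hmin : IsLocalMin f 0 := isLocalMin_of_deriv_deriv_pos (by rwa [hdd]) hmax.deriv_eq_zero
    h1.self_of_nhds.continuousAt
  -- A point that is both a local maximum and a local minimum forces `f` to be locally constant.
  have hconst : f =ᶠ[𝓝 0] fun _ => f 0 := by
    filter_upwards [hmax, hmin] with t h3 h4 using le_antisymm h3 h4
  have : f' =ᶠ[𝓝 0] fun _ => (0 : ℝ) := by
    filter_upwards [hd, hconst.deriv] with t h3 h4
    rw [← h3, h4, deriv_const]
  have h5 := (h2.congr_of_eventuallyEq this.symm).unique (hasDerivAt_const (0 : ℝ) (0 : ℝ))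
  exact ha.ne' h5

/-! ### Homogeneous functions -/

section Homogeneous
variable {E : Type*} [NormedAddCommGroup E] [NormedSpace ℝ E]
  {G : Type*} [NormedAddCommGroup G] [NormedSpace ℝ G]

/-- `F` is positively homogeneous of degree `-k`. -/
def IsHomog (k : ℕ) (F : E → G) : Prop :=
  ∀ r : ℝ, 0 < r → ∀ z, F (r • z) = (r ^ k)⁻¹ • F z

lemma IsHomog.fderiv {k : ℕ} {F : E → G} (h : IsHomog k F) : IsHomog (k + 1) (_root_.fderiv ℝ F) := by
  intro r hr z
  have h1 : _root_.fderiv ℝ (fun w => F (r • w)) z = r • _root_.fderiv ℝ F (r • z) :=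
    fderiv_comp_smul r
  have h2 : (fun w => F (r • w)) = (r ^ k)⁻¹ • F := funext fun w => h r hr w
  rw [h2, fderiv_const_smul_field] at h1
  have h3 : _root_.fderiv ℝ F (r • z) = r⁻¹ • (r ^ k)⁻¹ • _root_.fderiv ℝ F z := by
    rw [Pi.smul_apply] at h1
    rw [h1, inv_smul_smul₀ hr.ne']
  rw [h3, smul_smul, pow_succ, mul_inv, mul_comm]

lemma IsHomog.exists_norm_le [FiniteDimensional ℝ E] {k : ℕ} {F : E → G} (h : IsHomog k F)
    (hc : ContinuousOn F {0}ᶜ) : ∃ C, ∀ z ≠ 0, ‖F z‖ ≤ C / ‖z‖ ^ k := by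
  have : ProperSpace E := FiniteDimensional.proper ℝ E
  obtain ⟨C, hC⟩ := (isCompact_sphere (0 : E) 1).exists_bound_of_continuousOn
    (hc.mono fun z hz => by
      rintro rfl
      simp at hz)
  refine ⟨C, fun z hz => ?_⟩
  have hz' : 0 < ‖z‖ := norm_pos_iff.2 hz
  have h1 : F z = (‖z‖ ^ k)⁻¹ • F (‖z‖⁻¹ • z) := by
    rw [← h _ hz', smul_inv_smul₀ hz'.ne']
  have h2 : ‖F (‖z‖⁻¹ • z)‖ ≤ C := hC _ (by simp [norm_smul, hz'.ne'])
  rw [h1, norm_smul, norm_inv, norm_pow, norm_norm, div_eq_inv_mul]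
  gcongr

end Homogeneous

lemma slabDecay_of_norm_le {G : Type*} [NormedAddCommGroup G]
    {F : Euc (m + 1) → G} {C : ℝ} {k : ℕ} (hk : m + 1 ≤ k)
    (h : ∀ z ≠ 0, ‖F z‖ ≤ C / ‖z‖ ^ k) : SlabDecay F := by
  intro δ hδ R
  refine ⟨|C| / δ ^ (k - (m + 1)), fun z hz _ => ?_⟩
  have h1 : δ ≤ ‖z‖ := hz.trans ((le_abs_self _).trans (abs_last_le_norm z))
  have h0 : 0 < ‖z‖ := hδ.trans_le h1
  refine (h z (norm_pos_iff.1 h0)).trans ?_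
  obtain ⟨j, rfl⟩ := Nat.exists_eq_add_of_le hk
  rw [Nat.add_sub_cancel_left, div_div, pow_add, mul_comm (δ ^ j)]
  gcongr
  exact le_abs_self C

/-! ### The Poisson kernel of the half-space -/

/-- The constant `2 / ω_n`, `n = m + 1`, of the Poisson kernel. -/
def kernelConst (m : ℕ) : ℝ := 2 / sphereArea (m + 1)

/-- The function `z ↦ (2 / ω_n) zₙ / |z|ⁿ`, `n = m + 1`. The Poisson kernel of the half-space
at `x` and the boundary point `y` is its value at `x - (y, 0)`. -/
def poissonKernel (z : Euc (m + 1)) : ℝ :=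
  kernelConst m * (z (Fin.last m) / ‖z‖ ^ (m + 1))

/-- The Poisson integral of a function on the boundary of the half-space. -/
def poissonIntegral (g : Euc m → ℝ) (x : Euc (m + 1)) : ℝ :=
  ∫ y, g y • poissonKernel (x - pt y 0)

lemma kernelConst_pos (m : ℕ) : 0 < kernelConst m := by
  have h : 0 < sphereArea (m + 1) := by
    unfold sphereArea
    refine ENNReal.toReal_pos ?_ (measure_ne_top _ _)
    rw [Measure.toSphere_apply_univ]
    refine mul_ne_zero (by simp) (Metric.measure_ball_pos _ _ one_pos).ne'
  unfold kernelConst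
  positivity

lemma contDiffAt_poissonKernel {z : Euc (m + 1)} (hz : z ≠ 0) {k : WithTop ℕ∞} :
    ContDiffAt ℝ k (poissonKernel (m := m)) z := by
  unfold poissonKernel
  refine contDiffAt_const.mul (ContDiffAt.div ?_ ((contDiffAt_norm ℝ hz).pow _) (by simpa using hz))
  exact (EuclideanSpace.proj (𝕜 := ℝ) (Fin.last m)).contDiff.contDiffAt

lemma contDiffOn_poissonKernel {k : WithTop ℕ∞} :
    ContDiffOn ℝ k (poissonKernel (m := m)) {0}ᶜ :=
  fun _ hz => (contDiffAt_poissonKernel hz).contDiffWithinAt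

lemma contDiffOn_fderiv_poissonKernel {k : WithTop ℕ∞} :
    ContDiffOn ℝ k (fderiv ℝ (poissonKernel (m := m))) {0}ᶜ :=
  contDiffOn_poissonKernel.fderiv_of_isOpen isOpen_compl_singleton le_rfl

lemma continuousOn_fderiv_fderiv_poissonKernel :
    ContinuousOn (fderiv ℝ (fderiv ℝ (poissonKernel (m := m)))) {0}ᶜ :=
  contDiffOn_fderiv_poissonKernel.continuousOn_fderiv_of_isOpen (n := 1)
    isOpen_compl_singleton le_rfl

lemma halfSpace_subset_compl : halfSpace m ⊆ {0}ᶜ := fun _ hz => ne_zero_of_mem_halfSpace hz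

lemma isHomog_poissonKernel : IsHomog m (poissonKernel (m := m)) := by
  intro r hr z
  simp only [poissonKernel, norm_smul, PiLp.smul_apply, smul_eq_mul, Real.norm_eq_abs,
    abs_of_pos hr]
  rw [mul_pow, pow_succ r m]
  by_cases hz : z = 0
  · simp [hz]
  have : ‖z‖ ≠ 0 := norm_ne_zero_iff.2 hz
  field_simp

/-- The kernel itself is homogeneous of degree `-m` only; the numerator `zₙ`, bounded on slabs,
provides the missing power. -/
lemma slabDecay_poissonKernel : SlabDecay (poissonKernel (m := m)) := by
  intro δ hδ R
  refine ⟨kernelConst m * R, fun z hz hR => ?_⟩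
  have hc := kernelConst_pos m
  rw [poissonKernel, Real.norm_of_nonneg (by have := hδ.trans_le hz; positivity), mul_div_assoc]
  gcongr

lemma slabDecay_fderiv_poissonKernel : SlabDecay (fderiv ℝ (poissonKernel (m := m))) := by
  obtain ⟨C, hC⟩ := isHomog_poissonKernel.fderiv.exists_norm_le
    (contDiffOn_fderiv_poissonKernel (m := m) (k := 0)).continuousOn
  exact slabDecay_of_norm_le le_rfl hC

lemma slabDecay_fderiv_fderiv_poissonKernel :
    SlabDecay (fderiv ℝ (fderiv ℝ (poissonKernel (m := m)))) := by
  obtain ⟨C, hC⟩ := isHomog_poissonKernel.fderiv.fderiv.exists_norm_le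
    (continuousOn_fderiv_fderiv_poissonKernel (m := m))
  exact slabDecay_of_norm_le (Nat.le_succ _) hC

/-! ### Derivatives of the Poisson kernel -/

/-- Writing the denominator as a power of `‖z‖²`, which is polynomial along lines, makes the
derivatives of the kernel along lines elementary. -/
lemma inv_norm_pow_eq_rpow (z : Euc (m + 1)) :
    (‖z‖ ^ (m + 1))⁻¹ = (‖z‖ ^ 2) ^ (-((m : ℝ) + 1) / 2) := by
  rw [← Real.rpow_natCast ‖z‖ 2, ← Real.rpow_mul (norm_nonneg _), ← Real.rpow_natCast,
    ← Real.rpow_neg (norm_nonneg _)]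
  congr 1
  push_cast
  ring

lemma norm_add_smul_single_sq (z : Euc (m + 1)) (i : Fin (m + 1)) (t : ℝ) :
    ‖z + t • EuclideanSpace.single i (1 : ℝ)‖ ^ 2 = ‖z‖ ^ 2 + 2 * t * z i + t ^ 2 := by
  rw [norm_add_sq_real, inner_smul_right, norm_smul, EuclideanSpace.inner_single_right]
  simp
  ring

lemma hasDerivAt_norm_line_sq (z : Euc (m + 1)) (i : Fin (m + 1)) (t : ℝ) :
    HasDerivAt (fun t : ℝ => ‖z‖ ^ 2 + 2 * t * z i + t ^ 2) (2 * z i + 2 * t) t := by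
  have := ((((hasDerivAt_id t).const_mul 2).mul_const (z i)).const_add (‖z‖ ^ 2)).add
    ((hasDerivAt_id t).pow 2)
  refine this.congr_deriv ?_
  simp

lemma eventually_norm_line_sq_pos {z : Euc (m + 1)} (hz : z ≠ 0) (i : Fin (m + 1)) :
    ∀ᶠ t : ℝ in 𝓝 0, 0 < ‖z‖ ^ 2 + 2 * t * z i + t ^ 2 := by
  have : ContinuousAt (fun t : ℝ => ‖z‖ ^ 2 + 2 * t * z i + t ^ 2) 0 :=
    (hasDerivAt_norm_line_sq z i 0).continuousAt
  refine this.eventually (lt_mem_nhds ?_)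
  have := norm_pos_iff.2 hz
  simp
  positivity

/-- The `n`-th coordinate of the `i`-th unit vector. -/
def lastDelta (i : Fin (m + 1)) : ℝ := (EuclideanSpace.single i (1 : ℝ) : Euc (m + 1)) (Fin.last m)

lemma lastDelta_eq (i : Fin (m + 1)) : lastDelta i = if i = Fin.last m then 1 else 0 := by
  simp [lastDelta, eq_comm]

lemma hasDerivAt_poissonKernel_line (z : Euc (m + 1)) (i : Fin (m + 1)) {t : ℝ}
    (ht : 0 < ‖z‖ ^ 2 + 2 * t * z i + t ^ 2) :
    HasDerivAt (fun t : ℝ => poissonKernel (z + t • EuclideanSpace.single i (1 : ℝ)))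
      (kernelConst m * (lastDelta i * (‖z‖ ^ 2 + 2 * t * z i + t ^ 2) ^ (-((m : ℝ) + 1) / 2)
        + (z (Fin.last m) + t * lastDelta i) * ((2 * z i + 2 * t) * (-((m : ℝ) + 1) / 2) *
          (‖z‖ ^ 2 + 2 * t * z i + t ^ 2) ^ (-((m : ℝ) + 1) / 2 - 1)))) t := by
  have h1 : (fun t : ℝ => poissonKernel (z + t • EuclideanSpace.single i (1 : ℝ))) = fun t =>
      kernelConst m * ((z (Fin.last m) + t * lastDelta i) *
        (‖z‖ ^ 2 + 2 * t * z i + t ^ 2) ^ (-((m : ℝ) + 1) / 2)) := by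
    ext t
    rw [poissonKernel, div_eq_mul_inv, inv_norm_pow_eq_rpow, norm_add_smul_single_sq]
    simp [lastDelta]
  rw [h1]
  have h2 : HasDerivAt (fun t : ℝ => z (Fin.last m) + t * lastDelta i) (lastDelta i) t := by
    simpa using ((hasDerivAt_id t).mul_const (lastDelta i)).const_add (z (Fin.last m))
  exact (h2.mul ((hasDerivAt_norm_line_sq z i t).rpow_const (Or.inl ht.ne'))).const_mul _

lemma fderiv_poissonKernel_single {z : Euc (m + 1)} (hz : z ≠ 0) (i : Fin (m + 1)) :
    fderiv ℝ poissonKernel z (EuclideanSpace.single i 1) =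
      kernelConst m / ‖z‖ ^ (m + 1) *
        (lastDelta i - (m + 1) * z (Fin.last m) / ‖z‖ ^ 2 * z i) := by
  have hp := norm_pos_iff.2 hz
  have h1 := hasDerivAt_poissonKernel_line z i (t := 0) (by simp; positivity)
  have hd : DifferentiableAt ℝ (poissonKernel (m := m)) z :=
    (contDiffAt_poissonKernel hz (k := 1)).differentiableAt (by norm_num)
  have h2 : HasDerivAt (fun t : ℝ => z + t • EuclideanSpace.single i (1 : ℝ))
      (EuclideanSpace.single i 1) 0 := by
    simpa using ((hasDerivAt_id (0 : ℝ)).smul_const (EuclideanSpace.single i (1 : ℝ))).const_add z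
  have h3 := HasFDerivAt.comp_hasDerivAt (l := poissonKernel (m := m))
    (f := fun t : ℝ => z + t • EuclideanSpace.single i (1 : ℝ)) (l' := fderiv ℝ poissonKernel z) 0
    (by simpa using hd.hasFDerivAt) h2
  rw [h3.unique h1]
  have h4 : (‖z‖ ^ 2) ^ (-((m : ℝ) + 1) / 2 - 1) = (‖z‖ ^ (m + 1))⁻¹ / ‖z‖ ^ 2 := by
    rw [inv_norm_pow_eq_rpow, Real.rpow_sub_one (by positivity)]
  simp only [mul_zero, zero_mul, add_zero, ne_eq, OfNat.ofNat_ne_zero, not_false_eq_true, zero_pow]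
  rw [h4, ← inv_norm_pow_eq_rpow]
  field_simp
  ring

lemma fderiv_fderiv_poissonKernel_single {z : Euc (m + 1)} (hz : z ≠ 0) (i : Fin (m + 1)) :
    fderiv ℝ (fderiv ℝ poissonKernel) z (EuclideanSpace.single i 1) (EuclideanSpace.single i 1) =
      -(kernelConst m * ((m : ℝ) + 1) / (‖z‖ ^ (m + 1) * ‖z‖ ^ 2)) *
        (2 * lastDelta i * z i + z (Fin.last m)
          - z (Fin.last m) * (m + 3) / ‖z‖ ^ 2 * z i ^ 2) := by
  have hp := norm_pos_iff.2 hz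
  have h2 : HasDerivAt (fun t : ℝ => z (Fin.last m) + t * lastDelta i) (lastDelta i) 0 := by
    simpa using ((hasDerivAt_id (0 : ℝ)).mul_const (lastDelta i)).const_add (z (Fin.last m))
  have h3 : HasDerivAt (fun t : ℝ => (2 * z i + 2 * t) * (-((m : ℝ) + 1) / 2))
      (2 * (-((m : ℝ) + 1) / 2)) 0 := by
    simpa using (((hasDerivAt_id (0 : ℝ)).const_mul 2).const_add (2 * z i)).mul_const
      (-((m : ℝ) + 1) / 2)
  have h0 : (‖z‖ ^ 2 + 2 * 0 * z i + 0 ^ 2 : ℝ) ≠ 0 := by simp; exact hz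
  have hr : ∀ p : ℝ, HasDerivAt (fun t : ℝ => (‖z‖ ^ 2 + 2 * t * z i + t ^ 2) ^ p)
      ((2 * z i + 2 * 0) * p * (‖z‖ ^ 2 + 2 * 0 * z i + 0 ^ 2) ^ (p - 1)) 0 := fun p =>
    (hasDerivAt_norm_line_sq z i 0).rpow_const (Or.inl h0)
  have key := fderiv_fderiv_apply_eq (contDiffAt_poissonKernel hz)
    ((eventually_norm_line_sq_pos hz i).mono fun t ht => hasDerivAt_poissonKernel_line z i ht)
    ((((hr (-((m : ℝ) + 1) / 2)).const_mul (lastDelta i)).add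
      (h2.mul (h3.mul (hr (-((m : ℝ) + 1) / 2 - 1))))).const_mul (kernelConst m))
  rw [key]
  have h4 : (‖z‖ ^ 2) ^ (-((m : ℝ) + 1) / 2 - 1) = (‖z‖ ^ (m + 1))⁻¹ / ‖z‖ ^ 2 := by
    rw [inv_norm_pow_eq_rpow, Real.rpow_sub_one (by positivity)]
  have h5 : (‖z‖ ^ 2) ^ (-((m : ℝ) + 1) / 2 - 1 - 1) = (‖z‖ ^ (m + 1))⁻¹ / ‖z‖ ^ 2 / ‖z‖ ^ 2 := by
    rw [Real.rpow_sub_one (by positivity), h4]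
  simp only [Pi.mul_apply, mul_zero, zero_mul, add_zero, ne_eq, OfNat.ofNat_ne_zero, not_false_eq_true, zero_pow]
  rw [h5, h4]
  field_simp
  ring

lemma sum_lastDelta_mul (f : Fin (m + 1) → ℝ) : ∑ i, lastDelta i * f i = f (Fin.last m) := by
  simp [lastDelta_eq]

/-- The Poisson kernel is harmonic away from the origin. -/
lemma sum_fderiv_fderiv_poissonKernel {z : Euc (m + 1)} (hz : z ≠ 0) :
    ∑ i, fderiv ℝ (fderiv ℝ poissonKernel) z (EuclideanSpace.single i 1)
      (EuclideanSpace.single i 1) = 0 := by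
  have hp := norm_pos_iff.2 hz
  simp_rw [fderiv_fderiv_poissonKernel_single hz]
  rw [← Finset.mul_sum, Finset.sum_sub_distrib, Finset.sum_add_distrib, ← Finset.mul_sum,
    ← EuclideanSpace.real_norm_sq_eq]
  have : ∑ i, 2 * lastDelta i * z i = 2 * z (Fin.last m) := by
    rw [← sum_lastDelta_mul fun i => z i, Finset.mul_sum]
    exact Finset.sum_congr rfl fun i _ => by ring
  rw [this, Finset.sum_const, Finset.card_univ, Fintype.card_fin]
  simp only [nsmul_eq_mul]
  push_cast
  field_simp
  ring

/-- The gradient of the Poisson kernel. -/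
def kernelGrad (z : Euc (m + 1)) : Euc (m + 1) :=
  WithLp.toLp 2 fun i => fderiv ℝ poissonKernel z (EuclideanSpace.single i 1)

lemma norm_kernelGrad {z : Euc (m + 1)} (hz : z ≠ 0) :
    ‖kernelGrad z‖ = kernelConst m * (Real.sqrt (1 + ((m + 1 : ℕ) : ℝ) * (((m + 1 : ℕ) : ℝ) - 2) *
      (z (Fin.last m) / ‖z‖) ^ 2) / ‖z‖ ^ (m + 1)) := by
  have hp := norm_pos_iff.2 hz
  have hc := kernelConst_pos m
  rw [EuclideanSpace.norm_eq]
  have h1 : ∑ i, ‖kernelGrad z i‖ ^ 2 = (kernelConst m / ‖z‖ ^ (m + 1)) ^ 2 *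
      (1 + ((m + 1 : ℕ) : ℝ) * (((m + 1 : ℕ) : ℝ) - 2) * (z (Fin.last m) / ‖z‖) ^ 2) := by
    simp only [kernelGrad, Real.norm_eq_abs, sq_abs, fderiv_poissonKernel_single hz, mul_pow]
    rw [← Finset.mul_sum]
    congr 1
    set a := (m + 1) * z (Fin.last m) / ‖z‖ ^ 2 with ha
    have h2 : ∀ i, (lastDelta i - a * z i) ^ 2 =
        lastDelta i * (lastDelta i - 2 * a * z i) + a ^ 2 * z i ^ 2 := fun i => by ring
    simp_rw [h2]
    rw [Finset.sum_add_distrib, sum_lastDelta_mul, ← Finset.mul_sum,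
      ← EuclideanSpace.real_norm_sq_eq, lastDelta_eq, if_pos rfl, ha]
    push_cast
    field_simp
    ring
  rw [h1, Real.sqrt_mul (by positivity), Real.sqrt_sq (by positivity)]
  ring

lemma kernelGrad_ne_zero (hm : 1 ≤ m) {z : Euc (m + 1)} (hz : z ≠ 0) : kernelGrad z ≠ 0 := by
  rw [← norm_pos_iff, norm_kernelGrad hz]
  have hp := norm_pos_iff.2 hz
  have hc := kernelConst_pos m
  have h2 : (0 : ℝ) ≤ ((m + 1 : ℕ) : ℝ) - 2 := by
    have : (1 : ℝ) ≤ m := by exact_mod_cast hm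
    push_cast
    linarith
  positivity

lemma continuousOn_kernelGrad : ContinuousOn (kernelGrad (m := m)) {0}ᶜ := by
  refine (PiLp.continuous_toLp 2 _).comp_continuousOn (continuousOn_pi.2 fun i => ?_)
  exact (contDiffOn_fderiv_poissonKernel (k := 0)).continuousOn.clm_apply continuousOn_const

/-! ### Poisson integrals are harmonic -/

section
variable {g : Euc m → ℝ} {M : ℝ}

lemma continuousOn_poissonKernel : ContinuousOn (poissonKernel (m := m)) (halfSpace m) :=
  (contDiffOn_poissonKernel (k := 0)).continuousOn.mono halfSpace_subset_compl

lemma continuousOn_fderiv_poissonKernel :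
    ContinuousOn (fderiv ℝ (poissonKernel (m := m))) (halfSpace m) :=
  (contDiffOn_fderiv_poissonKernel (k := 0)).continuousOn.mono halfSpace_subset_compl

lemma hasFDerivAt_poissonIntegral (hg : AEStronglyMeasurable g volume) (hM : ∀ᵐ y, |g y| ≤ M)
    {x : Euc (m + 1)} (hx : x ∈ halfSpace m) :
    HasFDerivAt (poissonIntegral g) (∫ y, g y • fderiv ℝ poissonKernel (x - pt y 0)) x :=
  hasFDerivAt_integral_translate slabDecay_poissonKernel
    ((contDiffOn_poissonKernel.differentiableOn one_ne_zero).mono halfSpace_subset_compl)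
    slabDecay_fderiv_poissonKernel continuousOn_fderiv_poissonKernel hg hM hx

lemma hasFDerivAt_fderiv_poissonIntegral (hg : AEStronglyMeasurable g volume)
    (hM : ∀ᵐ y, |g y| ≤ M) {x : Euc (m + 1)} (hx : x ∈ halfSpace m) :
    HasFDerivAt (fderiv ℝ (poissonIntegral g))
      (∫ y, g y • fderiv ℝ (fderiv ℝ poissonKernel) (x - pt y 0)) x := by
  refine (hasFDerivAt_integral_translate slabDecay_fderiv_poissonKernel
    ((contDiffOn_fderiv_poissonKernel.differentiableOn one_ne_zero).mono halfSpace_subset_compl)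
    slabDecay_fderiv_fderiv_poissonKernel
    (continuousOn_fderiv_fderiv_poissonKernel.mono halfSpace_subset_compl)
    hg hM hx).congr_of_eventuallyEq ?_
  filter_upwards [isOpen_halfSpace.mem_nhds hx] with z hz
  exact (hasFDerivAt_poissonIntegral hg hM hz).fderiv

lemma contDiffOn_poissonIntegral (hg : AEStronglyMeasurable g volume) (hM : ∀ᵐ y, |g y| ≤ M) :
    ContDiffOn ℝ 2 (poissonIntegral g) (halfSpace m) := by
  have h0 : ContDiffOn ℝ (1 + 1) (poissonIntegral g) (halfSpace m) := by
    rw [contDiffOn_succ_iff_fderiv_of_isOpen isOpen_halfSpace]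
    refine ⟨fun x hx => (hasFDerivAt_poissonIntegral hg hM hx).differentiableAt.differentiableWithinAt,
      by simp, ?_⟩
    have h1 : ContDiffOn ℝ (0 + 1) (fderiv ℝ (poissonIntegral g)) (halfSpace m) := by
      rw [contDiffOn_succ_iff_fderiv_of_isOpen isOpen_halfSpace]
      refine ⟨fun x hx =>
        (hasFDerivAt_fderiv_poissonIntegral hg hM hx).differentiableAt.differentiableWithinAt,
        by simp, ?_⟩
      rw [contDiffOn_zero]
      refine (continuousOn_integral_translate slabDecay_fderiv_fderiv_poissonKernel
        (continuousOn_fderiv_fderiv_poissonKernel.mono halfSpace_subset_compl) hg hM).congr ?_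
      intro x hx
      exact (hasFDerivAt_fderiv_poissonIntegral hg hM hx).fderiv
    simpa using h1
  rwa [one_add_one_eq_two] at h0

open InnerProductSpace Laplacian in
lemma laplacian_poissonIntegral (hg : AEStronglyMeasurable g volume) (hM : ∀ᵐ y, |g y| ≤ M)
    {x : Euc (m + 1)} (hx : x ∈ halfSpace m) : (Δ (poissonIntegral g)) x = 0 := by
  have hint := integrable_translate slabDecay_fderiv_fderiv_poissonKernel
      (continuousOn_fderiv_fderiv_poissonKernel.mono halfSpace_subset_compl) hg hM hx
  rw [laplacian_eq_sum_fderiv, (hasFDerivAt_fderiv_poissonIntegral hg hM hx).fderiv]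
  have hint' : ∀ e : Euc (m + 1), Integrable fun y =>
      (g y • fderiv ℝ (fderiv ℝ poissonKernel) (x - pt y 0)) e := fun e =>
    hint.apply_continuousLinearMap e
  have h1 : ∀ e : Euc (m + 1),
      (∫ y, g y • fderiv ℝ (fderiv ℝ poissonKernel) (x - pt y 0)) e e =
        ∫ y, (g y • fderiv ℝ (fderiv ℝ poissonKernel) (x - pt y 0)) e e := fun e => by
    rw [ContinuousLinearMap.integral_apply hint, ContinuousLinearMap.integral_apply (hint' e)]
  simp_rw [h1]
  rw [← integral_finsetSum _ fun i _ => (hint' _).apply_continuousLinearMap _]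
  refine integral_eq_zero_of_ae (ae_of_all _ fun y => ?_)
  have hz : x - pt y 0 ≠ 0 := ne_zero_of_mem_halfSpace (sub_pt_zero_mem hx y)
  simp only [smul_apply, smul_eq_mul, Pi.zero_apply]
  rw [← Finset.mul_sum, sum_fderiv_fderiv_poissonKernel hz, mul_zero]

lemma harmonicOnNhd_poissonIntegral (hg : AEStronglyMeasurable g volume)
    (hM : ∀ᵐ y, |g y| ≤ M) :
    InnerProductSpace.HarmonicOnNhd (poissonIntegral g) (halfSpace m) := by
  intro x hx
  have hn := isOpen_halfSpace.mem_nhds hx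
  refine ⟨(contDiffOn_poissonIntegral hg hM).contDiffAt hn, ?_⟩
  filter_upwards [hn] with z hz
  exact laplacian_poissonIntegral hg hM hz

end

/-! ### Areas of spheres and radial integrals -/

lemma sphereArea_eq_mul_ball (k : ℕ) :
    sphereArea k = k * (volume : Measure (Euc k)).real (Metric.ball 0 1) := by
  unfold sphereArea
  rw [Measure.toSphere_apply_univ]
  simp [Measure.real]

lemma sphereArea_eq {k : ℕ} (hk : 1 ≤ k) :
    sphereArea k = 2 * Real.sqrt Real.pi ^ k / Real.Gamma (k / 2) := by
  have : Nonempty (Fin k) := ⟨⟨0, hk⟩⟩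
  have hk0 : (0 : ℝ) < k := by exact_mod_cast hk
  have hG := Real.Gamma_pos_of_pos (half_pos hk0)
  rw [sphereArea_eq_mul_ball, Measure.real, EuclideanSpace.volume_ball]
  simp only [ENNReal.ofReal_one, one_pow, one_mul, Fintype.card_fin]
  rw [ENNReal.toReal_ofReal (by positivity), Real.Gamma_add_one (by positivity)]
  field_simp

lemma sphereArea_one : sphereArea 1 = 2 := by
  rw [sphereArea_eq le_rfl]
  have := Real.sqrt_pos.2 Real.pi_pos
  rw [Nat.cast_one, Real.Gamma_one_half_eq]
  field_simp

lemma sphereArea_two : sphereArea 2 = 2 * Real.pi := by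
  rw [sphereArea_eq one_le_two]
  simp [Real.sq_sqrt Real.pi_pos.le]

lemma gamma_three_halves : Real.Gamma (3 / 2) = Real.sqrt Real.pi / 2 := by
  rw [show (3 / 2 : ℝ) = 1 / 2 + 1 by norm_num, Real.Gamma_add_one (by norm_num),
    Real.Gamma_one_half_eq]
  ring

lemma sphereArea_three : sphereArea 3 = 4 * Real.pi := by
  rw [sphereArea_eq (by norm_num)]
  have := Real.sqrt_pos.2 Real.pi_pos
  push_cast
  rw [gamma_three_halves, pow_succ, Real.sq_sqrt Real.pi_pos.le]
  field_simp
  ring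

lemma integral_sin_pow_half_pi_succ_succ (k : ℕ) :
    ∫ θ in (0 : ℝ)..(Real.pi / 2), Real.sin θ ^ (k + 2) =
      ((k : ℝ) + 1) / (k + 2) * ∫ θ in (0 : ℝ)..(Real.pi / 2), Real.sin θ ^ k := by
  rw [integral_sin_pow]
  simp

/-- Wallis integrals over `[0, π/2]` in terms of the Gamma function. -/
lemma integral_sin_pow_half_pi : ∀ k : ℕ,
    ∫ θ in (0 : ℝ)..(Real.pi / 2), Real.sin θ ^ k =
      Real.sqrt Real.pi * Real.Gamma (((k : ℝ) + 1) / 2) / (2 * Real.Gamma (((k : ℝ) + 2) / 2))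
  | 0 => by
    simp only [pow_zero, integral_one, CharP.cast_eq_zero, zero_add, sub_zero]
    rw [Real.Gamma_one_half_eq, Real.mul_self_sqrt Real.pi_pos.le]
    norm_num
  | 1 => by
    have := Real.sqrt_pos.2 Real.pi_pos
    simp only [pow_one, integral_sin, Real.cos_zero, Real.cos_pi_div_two, Nat.cast_one]
    norm_num
    rw [gamma_three_halves]
    field_simp
  | k + 2 => by
    rw [integral_sin_pow_half_pi_succ_succ, integral_sin_pow_half_pi k]
    have h1 : (((k + 2 : ℕ) : ℝ) + 1) / 2 = ((k : ℝ) + 1) / 2 + 1 := by push_cast; ring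
    have h2 : (((k + 2 : ℕ) : ℝ) + 2) / 2 = ((k : ℝ) + 2) / 2 + 1 := by push_cast; ring
    rw [h1, h2, Real.Gamma_add_one (by positivity), Real.Gamma_add_one (by positivity)]
    have := Real.Gamma_pos_of_pos (show (0 : ℝ) < ((k : ℝ) + 2) / 2 by positivity)
    field_simp

/-- The slices of the unit sphere of `ℝ^{m+1}` by horizontal hyperplanes give its area. -/
lemma sphereArea_succ (hm : 1 ≤ m) : sphereArea (m + 1) =
    2 * sphereArea m * ∫ θ in (0 : ℝ)..(Real.pi / 2), Real.sin θ ^ (m - 1) := by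
  obtain ⟨k, rfl⟩ := Nat.exists_eq_add_of_le' hm
  rw [Nat.add_sub_cancel, integral_sin_pow_half_pi, sphereArea_eq (by omega),
    sphereArea_eq (by omega)]
  have h1 := Real.Gamma_pos_of_pos (show (0 : ℝ) < ((k : ℝ) + 1) / 2 by positivity)
  have h2 := Real.Gamma_pos_of_pos (show (0 : ℝ) < ((k : ℝ) + 2) / 2 by positivity)
  have h3 : ((k + 1 + 1 : ℕ) : ℝ) / 2 = ((k : ℝ) + 2) / 2 := by push_cast; ring
  rw [h3]
  push_cast
  field_simp
  ring

lemma image_mul_tan {t : ℝ} (ht : 0 < t) :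
    (fun θ => t * Real.tan θ) '' Set.Ioo 0 (Real.pi / 2) = Set.Ioi 0 := by
  ext r
  constructor
  · rintro ⟨θ, ⟨h0, h1⟩, rfl⟩
    exact mul_pos ht (Real.tan_pos_of_pos_of_lt_pi_div_two h0 h1)
  · intro hr
    refine ⟨Real.arctan (r / t), ⟨?_, Real.arctan_lt_pi_div_two _⟩, ?_⟩
    · exact Real.arctan_pos.2 (div_pos hr ht)
    · simp only [Real.tan_arctan]
      field_simp

lemma injOn_mul_tan {t : ℝ} (ht : 0 < t) :
    Set.InjOn (fun θ => t * Real.tan θ) (Set.Ioo 0 (Real.pi / 2)) := by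
  intro a ha b hb hab
  refine Real.injOn_tan ⟨by linarith [ha.1, Real.pi_pos], ha.2⟩
    ⟨by linarith [hb.1, Real.pi_pos], hb.2⟩ ?_
  exact mul_left_cancel₀ ht.ne' hab

lemma norm_pt_eq_sqrt (y : Euc m) (t : ℝ) : ‖pt y t‖ = Real.sqrt (‖y‖ ^ 2 + t ^ 2) := by
  rw [← norm_pt_sq, Real.sqrt_sq (norm_nonneg _)]

/-- Integration in polar coordinates of the hyperplane at height `t`, the radius being
`t tan ϑ`. -/
lemma integral_cos_norm (hm : 1 ≤ m) (ψ : ℝ → ℝ) {t : ℝ} (ht : 0 < t) :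
    ∫ y : Euc m, ψ (t / ‖pt y t‖) / ‖pt y t‖ ^ (m + 1) =
      sphereArea m / t * ∫ θ in (0 : ℝ)..(Real.pi / 2), ψ (Real.cos θ) * Real.sin θ ^ (m - 1) := by
  have : Nonempty (Fin m) := ⟨⟨0, hm⟩⟩
  simp_rw [norm_pt_eq_sqrt]
  rw [integral_fun_norm_addHaar volume fun r => ψ (t / Real.sqrt (r ^ 2 + t ^ 2)) /
    Real.sqrt (r ^ 2 + t ^ 2) ^ (m + 1), ← image_mul_tan ht,
    integral_image_eq_integral_abs_deriv_smul measurableSet_Ioo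
      (f' := fun θ => t * (1 / Real.cos θ ^ 2)) _ (injOn_mul_tan ht)]
  · rw [finrank_euclideanSpace_fin, intervalIntegral.integral_of_le (by positivity),
      integral_Ioc_eq_integral_Ioo, nsmul_eq_mul, smul_eq_mul, ← mul_assoc,
      ← sphereArea_eq_mul_ball, div_mul_eq_mul_div, mul_div_assoc, ← integral_div]
    congr 1
    refine setIntegral_congr_fun measurableSet_Ioo fun θ hθ => ?_
    have hc : 0 < Real.cos θ := Real.cos_pos_of_mem_Ioo ⟨by linarith [hθ.1, Real.pi_pos], hθ.2⟩
    have h1 : Real.sqrt ((t * Real.tan θ) ^ 2 + t ^ 2) = t / Real.cos θ := by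
      rw [Real.sqrt_eq_iff_mul_self_eq (by positivity) (by positivity), Real.tan_eq_sin_div_cos]
      field_simp
      rw [Real.sin_sq_add_cos_sq]
    obtain ⟨k, rfl⟩ := Nat.exists_eq_add_of_le' hm
    simp only [h1, smul_eq_mul, Nat.add_sub_cancel]
    rw [abs_of_pos (by positivity), Real.tan_eq_sin_div_cos, div_div_cancel₀ ht.ne', mul_pow,
      div_pow, div_pow]
    field_simp
    ring
  · intro θ hθ
    have hc : 0 < Real.cos θ := Real.cos_pos_of_mem_Ioo ⟨by linarith [hθ.1, Real.pi_pos], hθ.2⟩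
    exact ((Real.hasDerivAt_tan hc.ne').const_mul t).hasDerivWithinAt

lemma sphereArea_pos {k : ℕ} (hk : 1 ≤ k) : 0 < sphereArea k := by
  have : (0 : ℝ) < k := by exact_mod_cast hk
  have := Real.Gamma_pos_of_pos (half_pos this)
  have := Real.sqrt_pos.2 Real.pi_pos
  rw [sphereArea_eq hk]
  positivity

lemma poissonKernel_pt (y : Euc m) (t : ℝ) :
    poissonKernel (pt y t) = kernelConst m * (t / ‖pt y t‖ ^ (m + 1)) := by
  rw [poissonKernel, pt_last]

/-- The Poisson kernel has total mass one. -/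
lemma integral_poissonKernel (hm : 1 ≤ m) {t : ℝ} (ht : 0 < t) :
    ∫ y : Euc m, poissonKernel (pt y t) = 1 := by
  have h := integral_cos_norm hm (fun _ => 1) ht
  simp only [one_mul] at h
  have h2 : ∀ y : Euc m, poissonKernel (pt y t) = kernelConst m * t * (1 / ‖pt y t‖ ^ (m + 1)) :=
    fun y => by rw [poissonKernel_pt]; ring
  simp_rw [h2]
  rw [integral_const_mul, h, kernelConst]
  have h3 := sphereArea_succ hm
  have h4 := sphereArea_pos (show 1 ≤ m + 1 by omega)
  field_simp
  rw [h3]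

lemma integral_norm_kernelGrad (hm : 1 ≤ m) {t : ℝ} (ht : 0 < t) :
    ∫ y : Euc m, ‖kernelGrad (pt y t)‖ = divConst (m + 1) / t := by
  have h := integral_cos_norm hm (fun c => Real.sqrt (1 + ((m + 1 : ℕ) : ℝ) *
    (((m + 1 : ℕ) : ℝ) - 2) * c ^ 2)) ht
  have h2 : ∀ y : Euc m, pt y t ≠ 0 := fun y => ne_zero_of_mem_halfSpace (pt_mem_halfSpace ht)
  simp_rw [fun y => norm_kernelGrad (h2 y), pt_last]
  rw [integral_const_mul, h, divConst, kernelConst, Nat.add_sub_cancel,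
    show m + 1 - 2 = m - 1 by omega]
  ring

/-! ### The constants in dimensions two and three -/

lemma divConst_two : divConst 2 = 1 := by
  rw [divConst, show 2 - 1 = 1 from rfl, sphereArea_one, sphereArea_two]
  simp
  field_simp

lemma hasDerivAt_sqrt_one_add_antideriv (c : ℝ) :
    HasDerivAt (fun c : ℝ => c / 2 * Real.sqrt (1 + 3 * c ^ 2) +
      Real.arsinh (Real.sqrt 3 * c) / (2 * Real.sqrt 3)) (Real.sqrt (1 + 3 * c ^ 2)) c := by
  have h3 : (0 : ℝ) < Real.sqrt 3 := by positivity
  have hq : (0 : ℝ) < 1 + 3 * c ^ 2 := by positivity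
  have h1 : HasDerivAt (fun c : ℝ => 1 + 3 * c ^ 2) (6 * c) c := by
    refine (((hasDerivAt_id c).pow 2).const_mul 3 |>.const_add 1).congr_deriv ?_
    simp
    ring
  have h2 := h1.sqrt hq.ne'
  have h4 := ((hasDerivAt_id c).const_mul (Real.sqrt 3)).arsinh
  refine ((((hasDerivAt_id c).div_const 2).mul h2).add (h4.div_const (2 * Real.sqrt 3))).congr_deriv
    ?_
  have hs : 0 < Real.sqrt (1 + 3 * c ^ 2) := Real.sqrt_pos.2 hq
  simp only [id_eq, mul_pow, smul_eq_mul]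
  rw [Real.sq_sqrt (show (0 : ℝ) ≤ 3 by norm_num)]
  field_simp
  rw [Real.sq_sqrt hq.le]
  ring

lemma divConst_three :
    divConst 3 = 1 + Real.sqrt 3 / 6 * Real.log (2 + Real.sqrt 3) := by
  have h3 : (0 : ℝ) < Real.sqrt 3 := by positivity
  rw [divConst, show 3 - 1 = 2 from rfl, sphereArea_two, sphereArea_three]
  have hd : ∀ θ : ℝ, HasDerivAt (fun θ : ℝ => -(Real.cos θ / 2 *
      Real.sqrt (1 + 3 * Real.cos θ ^ 2) +
      Real.arsinh (Real.sqrt 3 * Real.cos θ) / (2 * Real.sqrt 3)))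
      (Real.sqrt (1 + 3 * Real.cos θ ^ 2) * Real.sin θ) θ := fun θ => by
    refine ((hasDerivAt_sqrt_one_add_antideriv (Real.cos θ)).comp θ
      (Real.hasDerivAt_cos θ)).neg.congr_deriv ?_
    ring
  have h1 : ∫ θ in (0 : ℝ)..(Real.pi / 2), Real.sqrt (1 + ((3 : ℕ) : ℝ) * (((3 : ℕ) : ℝ) - 2) *
      Real.cos θ ^ 2) * Real.sin θ ^ (3 - 2) =
      ∫ θ in (0 : ℝ)..(Real.pi / 2), Real.sqrt (1 + 3 * Real.cos θ ^ 2) * Real.sin θ := by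
    congr 1
    ext θ
    norm_num
  rw [h1, intervalIntegral.integral_eq_sub_of_hasDerivAt (fun θ _ => hd θ)
    ((by fun_prop : Continuous fun θ : ℝ =>
      Real.sqrt (1 + 3 * Real.cos θ ^ 2) * Real.sin θ).intervalIntegrable _ _)]
  have h4 : Real.sqrt (1 + 3) = 2 := by
    rw [show (1 + 3 : ℝ) = 2 ^ 2 by norm_num, Real.sqrt_sq (by norm_num)]
  simp only [Real.cos_pi_div_two, Real.cos_zero, mul_zero, mul_one, one_pow,
    Real.arsinh, Real.sq_sqrt (show (0 : ℝ) ≤ 3 by norm_num), h4]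
  rw [add_comm (Real.sqrt 3) 2]
  simp
  field_simp
  linear_combination (-4 * Real.log (2 + Real.sqrt 3)) *
    Real.mul_self_sqrt (show (0 : ℝ) ≤ 3 by norm_num)

/-! ### A maximum principle for the half-space -/

/-- The weight of the logarithm in `barrier`, small enough for `barrier` to be superharmonic. -/
def barrierConst (m : ℕ) : ℝ := 1 / (8 * ((m : ℝ) + 1))

/-- A positive, strictly superharmonic function on the half-space that tends to `∞` at infinity.
The logarithm makes it grow in all directions but is subharmonic in dimension `n ≥ 3`; the concave
function `√(1 + zₙ)` compensates for that. -/
def barrier (z : Euc (m + 1)) : ℝ :=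
  Real.sqrt (1 + z (Fin.last m)) + barrierConst m * Real.log (‖z + pt 0 1‖ ^ 2)

lemma barrierConst_pos (m : ℕ) : 0 < barrierConst m := by unfold barrierConst; positivity

lemma one_add_last_le_norm (z : Euc (m + 1)) : 1 + z (Fin.last m) ≤ ‖z + pt 0 1‖ := by
  have := (le_abs_self _).trans (abs_last_le_norm (z + pt 0 1))
  simpa [add_comm] using this

lemma one_le_norm_add {z : Euc (m + 1)} (hz : z ∈ halfSpace m) : 1 ≤ ‖z + pt 0 1‖ := by
  have h := one_add_last_le_norm z
  have : 0 < z (Fin.last m) := hz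
  linarith

lemma log_nonneg_of_mem {z : Euc (m + 1)} (hz : z ∈ halfSpace m) :
    0 ≤ Real.log (‖z + pt 0 1‖ ^ 2) :=
  Real.log_nonneg (one_le_pow₀ (one_le_norm_add hz))

lemma barrier_pos {z : Euc (m + 1)} (hz : z ∈ halfSpace m) : 0 < barrier z := by
  have h1 := log_nonneg_of_mem hz
  have h2 := barrierConst_pos m
  have h3 : 0 < Real.sqrt (1 + z (Fin.last m)) := by
    have : 0 < z (Fin.last m) := hz
    positivity
  unfold barrier
  positivity

lemma continuousOn_barrier : ContinuousOn (barrier (m := m)) (halfSpace m) := by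
  unfold barrier
  refine ContinuousOn.add (by fun_prop) (continuousOn_const.mul (ContinuousOn.log (by fun_prop) ?_))
  intro z hz
  have := one_le_norm_add hz
  positivity

/-- The second derivative of `barrier` in the `i`-th coordinate direction. -/
def barrierSecond (z : Euc (m + 1)) (i : Fin (m + 1)) : ℝ :=
  -(lastDelta i / (4 * Real.sqrt (1 + z (Fin.last m)) ^ 3)) +
    barrierConst m * (2 / ‖z + pt 0 1‖ ^ 2 - 4 / ‖z + pt 0 1‖ ^ 4 * (z + pt 0 1 : Euc (m + 1)) i ^ 2)

/-- Along coordinate lines `barrier` is twice differentiable, with second derivative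
`barrierSecond`. -/
lemma exists_hasDerivAt_barrier_line {z : Euc (m + 1)} (hz : z ∈ halfSpace m) (i : Fin (m + 1)) :
    ∃ φ : ℝ → ℝ, (∀ᶠ t in 𝓝 (0 : ℝ),
      HasDerivAt (fun t : ℝ => barrier (z + t • EuclideanSpace.single i (1 : ℝ))) (φ t) t) ∧
      HasDerivAt φ (barrierSecond z i) 0 := by
  set w := z + pt 0 1 with hw
  have hz' : 0 < z (Fin.last m) := hz
  have hwn : 0 < ‖w‖ := one_pos.trans_le (one_le_norm_add hz)
  have hw0 : w ≠ 0 := norm_pos_iff.1 hwn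
  have hline : (fun t : ℝ => barrier (z + t • EuclideanSpace.single i (1 : ℝ))) = fun t =>
      Real.sqrt (1 + z (Fin.last m) + t * lastDelta i) +
        barrierConst m * Real.log (‖w‖ ^ 2 + 2 * t * w i + t ^ 2) := by
    ext t
    rw [barrier, add_right_comm, ← hw, norm_add_smul_single_sq]
    simp [lastDelta, add_assoc]
  have hlin : ∀ t : ℝ, HasDerivAt (fun t : ℝ => 1 + z (Fin.last m) + t * lastDelta i)
      (lastDelta i) t := fun t => by
    simpa using ((hasDerivAt_id t).mul_const (lastDelta i)).const_add (1 + z (Fin.last m))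
  have hpos : ∀ᶠ t : ℝ in 𝓝 0, 0 < 1 + z (Fin.last m) + t * lastDelta i :=
    (hlin 0).continuousAt.eventually (lt_mem_nhds (by simp; positivity))
  refine ⟨fun t => lastDelta i / (2 * Real.sqrt (1 + z (Fin.last m) + t * lastDelta i)) +
    barrierConst m * ((2 * w i + 2 * t) / (‖w‖ ^ 2 + 2 * t * w i + t ^ 2)), ?_, ?_⟩
  · rw [hline]
    filter_upwards [hpos, eventually_norm_line_sq_pos hw0 i] with t h1 h2
    exact ((hlin t).sqrt h1.ne').add
      (((hasDerivAt_norm_line_sq w i t).log h2.ne').const_mul (barrierConst m))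
  · have hs : 0 < Real.sqrt (1 + z (Fin.last m)) := by positivity
    have h1 := (hasDerivAt_const (0 : ℝ) (lastDelta i)).div
      (((hlin 0).sqrt hpos.self_of_nhds.ne').const_mul 2) (by simpa using hs.ne')
    have h2 : HasDerivAt (fun t : ℝ => 2 * w i + 2 * t) 2 0 := by
      simpa using ((hasDerivAt_id (0 : ℝ)).const_mul 2).const_add (2 * w i)
    have h3 := (h2.div (hasDerivAt_norm_line_sq w i 0)
      (eventually_norm_line_sq_pos hw0 i).self_of_nhds.ne').const_mul (barrierConst m)
    refine (h1.add h3).congr_deriv ?_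
    -- The computation produces `lastDelta i ^ 2`, and `lastDelta i` is `0` or `1`.
    have hd : lastDelta i ^ 2 = lastDelta i := by rw [lastDelta_eq]; split_ifs <;> simp
    have h4 : lastDelta i / (4 * Real.sqrt (1 + z (Fin.last m)) ^ 3) =
        lastDelta i ^ 2 / (4 * Real.sqrt (1 + z (Fin.last m)) ^ 3) := by rw [hd]
    rw [barrierSecond, ← hw, h4]
    simp only [mul_zero, zero_mul, add_zero, ne_eq, OfNat.ofNat_ne_zero, not_false_eq_true,
      zero_pow, zero_sub]
    field_simp
    ring

/-- `barrier` is strictly superharmonic. -/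
lemma sum_barrierSecond_neg {z : Euc (m + 1)} (hz : z ∈ halfSpace m) :
    ∑ i, barrierSecond z i < 0 := by
  have hz' : 0 < z (Fin.last m) := hz
  set w := z + pt 0 1 with hw
  have hwn : 0 < ‖w‖ := one_pos.trans_le (one_le_norm_add hz)
  set s := Real.sqrt (1 + z (Fin.last m)) with hs
  have hs1 : 1 ≤ s := Real.one_le_sqrt.2 (by linarith)
  have hs2 : s ^ 2 = 1 + z (Fin.last m) := Real.sq_sqrt (by linarith)
  have hone : ∑ i : Fin (m + 1), lastDelta i = 1 := by simp [lastDelta_eq]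
  have h1 : ∑ i, barrierSecond z i =
      -(1 / (4 * s ^ 3)) + barrierConst m * (2 * ((m : ℝ) - 1) / ‖w‖ ^ 2) := by
    unfold barrierSecond
    rw [← hw, ← hs, Finset.sum_add_distrib, ← Finset.mul_sum, Finset.sum_sub_distrib,
      Finset.sum_const, ← Finset.mul_sum, ← EuclideanSpace.real_norm_sq_eq w, Finset.card_univ,
      Fintype.card_fin, Finset.sum_neg_distrib, ← Finset.sum_div,
      hone]
    simp only [nsmul_eq_mul]
    push_cast
    field_simp
    ring
  have h2 : s ^ 3 ≤ ‖w‖ ^ 2 := by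
    have h3 : s ^ 2 ≤ ‖w‖ := hs2.le.trans (one_add_last_le_norm z)
    calc s ^ 3 ≤ s ^ 4 := pow_le_pow_right₀ hs1 (by norm_num)
      _ = (s ^ 2) ^ 2 := by ring
      _ ≤ ‖w‖ ^ 2 := by gcongr
  have h4 : barrierConst m * (2 * ((m : ℝ) - 1) / ‖w‖ ^ 2) < 1 / (4 * ‖w‖ ^ 2) := by
    unfold barrierConst
    rw [div_mul_div_comm, div_lt_div_iff₀ (by positivity) (by positivity)]
    have : 0 < ‖w‖ ^ 2 := by positivity
    nlinarith
  have h5 : 1 / (4 * ‖w‖ ^ 2) ≤ 1 / (4 * s ^ 3) := by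
    gcongr
  rw [h1]
  linarith

/-- Sublevel sets of `barrier` are bounded. -/
lemma norm_le_of_barrier_le {z : Euc (m + 1)} (hz : z ∈ halfSpace m) {B : ℝ}
    (h : barrier z ≤ B) : ‖z‖ ≤ Real.exp (B / barrierConst m) + 1 := by
  have hc := barrierConst_pos m
  have h1 : Real.log (‖z + pt 0 1‖ ^ 2) ≤ B / barrierConst m := by
    rw [le_div_iff₀ hc]
    have := Real.sqrt_nonneg (1 + z (Fin.last m))
    unfold barrier at h
    linarith
  have h2 := one_le_norm_add hz
  have h3 : ‖z + pt 0 1‖ ^ 2 ≤ Real.exp (B / barrierConst m) :=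
    (Real.log_le_iff_le_exp (by positivity)).1 h1
  have h4 : ‖z‖ ≤ ‖z + pt 0 1‖ + ‖(pt 0 1 : Euc (m + 1))‖ := by
    have := norm_sub_le (z + pt 0 1) (pt 0 1)
    rwa [add_sub_cancel_right] at this
  have h5 : ‖(pt 0 1 : Euc (m + 1))‖ = 1 := by
    rw [norm_pt_eq_sqrt]
    simp
  nlinarith

open InnerProductSpace in
/-- Phragmén–Lindelöf principle: a harmonic function on the half-space that is bounded above and
has boundary values zero is nowhere positive. -/
theorem nonpos_of_harmonicOnNhd {v : Euc (m + 1) → ℝ} (hv : HarmonicOnNhd v (halfSpace m))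
    {M : ℝ} (hM : ∀ z ∈ halfSpace m, v z ≤ M)
    (hb : ∀ y : Euc m, Tendsto v (𝓝[halfSpace m] (pt y 0)) (𝓝 0)) {z₀ : Euc (m + 1)}
    (hz₀ : z₀ ∈ halfSpace m) : v z₀ ≤ 0 := by
  by_contra! hpos
  have hh0 := barrier_pos hz₀
  -- `ε` is small enough for `v - ε * barrier` to remain positive at `z₀`.
  set ε := v z₀ / (2 * barrier z₀) with hε
  have hε0 : 0 < ε := by positivity
  set w : Euc (m + 1) → ℝ := fun z => v z - ε * barrier z with hw
  have hw0 : 0 < w z₀ := by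
    have : w z₀ = v z₀ / 2 := by simp only [hw, hε]; field_simp; ring
    rw [this]
    positivity
  have hwv : ∀ z ∈ halfSpace m, w z ≤ v z := fun z hz => by
    have := mul_pos hε0 (barrier_pos hz)
    simp only [hw]
    linarith
  have hwc : ContinuousOn w (halfSpace m) :=
    hv.continuousOn.sub (continuousOn_const.mul continuousOn_barrier)
  set S := {z | z ∈ halfSpace m ∧ w z₀ ≤ w z} with hS
  have hSH : S ⊆ halfSpace m := fun z hz => hz.1
  -- The barrier keeps `S` bounded, the boundary values keep it away from the boundary.
  have hSc : IsCompact S := by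
    refine Metric.isCompact_of_isClosed_isBounded ?_ ?_
    · refine isClosed_of_closure_subset fun z hz => ?_
      have hne : (𝓝[S] z).NeBot := mem_closure_iff_nhdsWithin_neBot.1 hz
      have hz0 : 0 ≤ z (Fin.last m) := by
        have hcl : IsClosed {z : Euc (m + 1) | 0 ≤ z (Fin.last m)} :=
          isClosed_le continuous_const (by fun_prop)
        exact closure_minimal (t := {z : Euc (m + 1) | 0 ≤ z (Fin.last m)})
          (fun z hz => show 0 ≤ z (Fin.last m) from
            le_of_lt (show 0 < z (Fin.last m) from hSH hz)) hcl hz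
      have hge : ∀ᶠ x in 𝓝[S] z, w z₀ ≤ w x := eventually_mem_nhdsWithin.mono fun x hx => hx.2
      rcases hz0.eq_or_lt with h0 | h0
      · exfalso
        have h1 : Tendsto v (𝓝[S] z) (𝓝 0) := by
          have hz' : pt (base z) 0 = z := by rw [h0, pt_base]
          have := hb (base z)
          rw [hz'] at this
          exact this.mono_left (nhdsWithin_mono _ hSH)
        have h2 : w z₀ ≤ 0 := ge_of_tendsto h1 <| by
          filter_upwards [hge, eventually_mem_nhdsWithin] with x hx hxS
          exact hx.trans (hwv x (hSH hxS))
        linarith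
      · have hzH : z ∈ halfSpace m := h0
        exact ⟨hzH, ge_of_tendsto ((hwc z hzH).mono_left (nhdsWithin_mono _ hSH)) hge⟩
    · refine (Metric.isBounded_closedBall (x := (0 : Euc (m + 1)))
        (r := Real.exp (M / ε / barrierConst m) + 1)).subset fun z hz => ?_
      rw [mem_closedBall_zero_iff]
      refine norm_le_of_barrier_le hz.1 ?_
      rw [le_div_iff₀ hε0]
      have h1 := hM z hz.1
      have h2 := hz.2
      simp only [hw] at h2 hw0
      linarith
  obtain ⟨z₁, hz₁, hmax⟩ := hSc.exists_isMaxOn ⟨z₀, hz₀, le_rfl⟩ (hwc.mono hSH)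
  have hz₁H := hSH hz₁
  have hloc : IsLocalMax w z₁ := by
    filter_upwards [isOpen_halfSpace.mem_nhds hz₁H] with z hz
    by_cases hzS : w z₀ ≤ w z
    · exact hmax ⟨hz, hzS⟩
    · exact (not_le.1 hzS).le.trans hz₁.2
  have hsum : ∑ i, fderiv ℝ (fderiv ℝ v) z₁ (EuclideanSpace.single i 1)
      (EuclideanSpace.single i 1) = 0 := by
    rw [← laplacian_eq_sum_fderiv]
    exact (hv z₁ hz₁H).2.self_of_nhds
  -- Summed over `i`, the second derivative test at the maximum of `w` contradicts the strict
  -- superharmonicity of the barrier.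
  have hle : ∀ i, fderiv ℝ (fderiv ℝ v) z₁ (EuclideanSpace.single i 1)
      (EuclideanSpace.single i 1) - ε * barrierSecond z₁ i ≤ 0 := fun i => by
    obtain ⟨φ, hφ1, hφ2⟩ := exists_hasDerivAt_barrier_line hz₁H i
    have hcd := (hv z₁ hz₁H).1
    have hline : Tendsto (fun t : ℝ => z₁ + t • EuclideanSpace.single i (1 : ℝ)) (𝓝 0) (𝓝 z₁) := by
      simpa using (hasDerivAt_line z₁ (EuclideanSpace.single i (1 : ℝ)) 0).continuousAt.tendsto
    refine nonpos_of_isLocalMax_of_hasDerivAt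
      (f := fun t : ℝ => w (z₁ + t • EuclideanSpace.single i (1 : ℝ))) ?_ ?_
      ((hasDerivAt_fderiv_comp_line hcd).sub (hφ2.const_mul ε))
    · have := hline.eventually hloc
      simpa [IsLocalMax, IsMaxFilter] using this
    · filter_upwards [eventually_hasDerivAt_comp_line hcd, hφ1] with t h1 h2
      exact h1.sub (h2.const_mul ε)
  have h1 : ∑ i, (fderiv ℝ (fderiv ℝ v) z₁ (EuclideanSpace.single i 1)
      (EuclideanSpace.single i 1) - ε * barrierSecond z₁ i) ≤ 0 :=
    Finset.sum_nonpos fun i _ => hle i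
  rw [Finset.sum_sub_distrib, hsum, ← Finset.mul_sum] at h1
  have h2 := mul_neg_of_pos_of_neg hε0 (sum_barrierSecond_neg hz₁H)
  linarith

open InnerProductSpace in
/-- Uniqueness for the Dirichlet problem in the class of bounded functions. -/
theorem eqOn_of_harmonicOnNhd {f g : Euc (m + 1) → ℝ} (hf : HarmonicOnNhd f (halfSpace m))
    (hg : HarmonicOnNhd g (halfSpace m)) {M N : ℝ} (hM : ∀ z ∈ halfSpace m, |f z| ≤ M)
    (hN : ∀ z ∈ halfSpace m, |g z| ≤ N) {b : Euc m → ℝ}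
    (hfb : ∀ y : Euc m, Tendsto f (𝓝[halfSpace m] (pt y 0)) (𝓝 (b y)))
    (hgb : ∀ y : Euc m, Tendsto g (𝓝[halfSpace m] (pt y 0)) (𝓝 (b y))) :
    Set.EqOn f g (halfSpace m) := by
  intro z hz
  have h1 : (f - g) z ≤ 0 := by
    refine nonpos_of_harmonicOnNhd (M := M + N) (hf.sub hg) (fun z hz => ?_) (fun y => ?_) hz
    · have := abs_le.1 (hM z hz)
      have := abs_le.1 (hN z hz)
      simp only [Pi.sub_apply]
      linarith
    · have := (hfb y).sub (hgb y)
      rwa [sub_self] at this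
  have h2 : (g - f) z ≤ 0 := by
    refine nonpos_of_harmonicOnNhd (M := M + N) (hg.sub hf) (fun z hz => ?_) (fun y => ?_) hz
    · have := abs_le.1 (hM z hz)
      have := abs_le.1 (hN z hz)
      simp only [Pi.sub_apply]
      linarith
    · have := (hgb y).sub (hfb y)
      rwa [sub_self] at this
  simp only [Pi.sub_apply] at h1 h2
  linarith

/-! ### Bounds and boundary limits of Poisson integrals -/

lemma sub_pt_zero_eq (x : Euc (m + 1)) (y : Euc m) :
    x - pt y 0 = pt (base x - y) (x (Fin.last m)) := by
  conv_lhs => rw [← pt_base x]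
  rw [pt_sub_pt, sub_zero]

lemma poissonKernel_pos {z : Euc (m + 1)} (hz : z ∈ halfSpace m) : 0 < poissonKernel z := by
  have h1 : 0 < z (Fin.last m) := hz
  have h2 := norm_pos_iff.2 (ne_zero_of_mem_halfSpace hz)
  have h3 := kernelConst_pos m
  unfold poissonKernel
  positivity

lemma integrable_poissonKernel_sub {x : Euc (m + 1)} (hx : x ∈ halfSpace m) :
    Integrable fun y : Euc m => poissonKernel (x - pt y 0) := by
  have := integrable_translate (g := fun _ => (1 : ℝ)) (M := 1) slabDecay_poissonKernel
    continuousOn_poissonKernel aestronglyMeasurable_const (by simp) hx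
  simpa using this

lemma integral_poissonKernel_sub (hm : 1 ≤ m) {x : Euc (m + 1)} (hx : x ∈ halfSpace m) :
    ∫ y : Euc m, poissonKernel (x - pt y 0) = 1 := by
  simp_rw [sub_pt_zero_eq]
  rw [integral_sub_left_eq_self fun y : Euc m => poissonKernel (pt y (x (Fin.last m)))]
  exact integral_poissonKernel hm hx

lemma continuous_poissonKernel_pt {t : ℝ} (ht : 0 < t) :
    Continuous fun y : Euc m => poissonKernel (pt y t) :=
  continuousOn_poissonKernel.comp_continuous (continuous_pt_left t) fun _ => pt_mem_halfSpace ht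

lemma integrable_poissonKernel_pt {t : ℝ} (ht : 0 < t) :
    Integrable fun y : Euc m => poissonKernel (pt y t) := by
  have h := integrable_poissonKernel_sub (pt_mem_halfSpace (m := m) (y := 0) ht)
  simp_rw [sub_pt_zero_eq, base_pt, pt_last, zero_sub] at h
  simpa using h.comp_neg

section
variable {g : Euc m → ℝ} {M : ℝ}

lemma abs_poissonIntegral_le (hm : 1 ≤ m) (hM : ∀ᵐ y, |g y| ≤ M) {x : Euc (m + 1)}
    (hx : x ∈ halfSpace m) : |poissonIntegral g x| ≤ M := by
  have h := integrable_poissonKernel_sub hx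
  have h1 : ‖∫ y, g y • poissonKernel (x - pt y 0)‖ ≤ ∫ y, M * poissonKernel (x - pt y 0) := by
    refine norm_integral_le_of_norm_le (h.const_mul M) ?_
    filter_upwards [hM] with y hy
    have hp := poissonKernel_pos (sub_pt_zero_mem hx y)
    rw [norm_smul, Real.norm_of_nonneg hp.le]
    exact mul_le_mul_of_nonneg_right hy hp.le
  rwa [integral_const_mul, integral_poissonKernel_sub hm hx, mul_one] at h1

/-- Rescaling the boundary variable turns the Poisson kernel at height `t` into the one at
height `1`. -/
lemma poissonIntegral_pt (g : Euc m → ℝ) (x : Euc m) {t : ℝ} (ht : 0 < t) :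
    poissonIntegral g (pt x t) = ∫ w : Euc m, g (x - t • w) * poissonKernel (pt w 1) := by
  have h1 : poissonIntegral g (pt x t) = ∫ y : Euc m, g (x - y) * poissonKernel (pt y t) := by
    rw [← integral_sub_left_eq_self (fun y : Euc m => g (x - y) * poissonKernel (pt y t)) volume x]
    refine integral_congr_ae (ae_of_all _ fun y => ?_)
    simp only [smul_eq_mul]
    rw [sub_pt_zero_eq, base_pt, pt_last, sub_sub_cancel]
  have h2 := Measure.integral_comp_smul volume
    (fun y : Euc m => g (x - y) * poissonKernel (pt y t)) t
  rw [← h1, finrank_euclideanSpace_fin, abs_of_pos (by positivity), smul_eq_mul,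
    eq_inv_mul_iff_mul_eq₀ (by positivity), ← integral_const_mul] at h2
  rw [← h2]
  refine integral_congr_ae (ae_of_all _ fun y => ?_)
  have h3 : poissonKernel (pt (t • y) t) = (t ^ m)⁻¹ • poissonKernel (pt y 1) := by
    rw [← isHomog_poissonKernel t ht, smul_pt, mul_one]
  simp only [h3, smul_eq_mul]
  field_simp

/-- The rescaled Poisson integral makes sense also at height zero and below, and is jointly
continuous there. -/
lemma continuous_scaled_poissonIntegral (hg : Continuous g) (hM : ∀ y, |g y| ≤ M) :
    Continuous fun p : Euc m × ℝ => ∫ w : Euc m, g (p.1 - p.2 • w) * poissonKernel (pt w 1) := by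
  refine continuous_of_dominated (bound := fun w => M * poissonKernel (pt w 1)) (fun p => ?_)
    (fun p => ae_of_all _ fun w => ?_) ((integrable_poissonKernel_pt one_pos).const_mul M)
    (ae_of_all _ fun w => ?_)
  · exact (Continuous.mul (by fun_prop)
      (continuous_poissonKernel_pt one_pos)).aestronglyMeasurable
  · have hp := poissonKernel_pos (pt_mem_halfSpace (y := w) one_pos)
    rw [norm_mul, Real.norm_of_nonneg hp.le]
    exact mul_le_mul_of_nonneg_right (hM _) hp.le
  · fun_prop

/-- The Poisson integral of a bounded continuous function attains its boundary values
continuously. -/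
lemma tendsto_poissonIntegral (hm : 1 ≤ m) (hg : Continuous g) (hM : ∀ y, |g y| ≤ M)
    (y : Euc m) : Tendsto (poissonIntegral g) (𝓝[halfSpace m] (pt y 0)) (𝓝 (g y)) := by
  have h1 := (continuous_scaled_poissonIntegral hg hM).tendsto (y, 0)
  simp only [zero_smul, sub_zero] at h1
  rw [integral_const_mul, integral_poissonKernel hm one_pos, mul_one] at h1
  have h2 : Continuous fun z : Euc (m + 1) => (base z, z (Fin.last m)) := by fun_prop
  have h3 := h2.tendsto (pt y 0)
  rw [base_pt, pt_last] at h3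
  refine ((h1.comp h3).mono_left nhdsWithin_le_nhds).congr' ?_
  filter_upwards [eventually_mem_nhdsWithin] with z hz
  simp only [Function.comp_apply]
  rw [← poissonIntegral_pt g (base z) hz, pt_base]

/-- A bounded harmonic function that extends continuously to the boundary is the Poisson integral
of its boundary values. -/
lemma eqOn_poissonIntegral (hm : 1 ≤ m) {f : Euc (m + 1) → ℝ}
    (hf : InnerProductSpace.HarmonicOnNhd f (halfSpace m))
    (hfM : ∀ z ∈ halfSpace m, |f z| ≤ M) (hg : Continuous g) (hM : ∀ y, |g y| ≤ M)
    (hfg : ∀ y : Euc m, Tendsto f (𝓝[halfSpace m] (pt y 0)) (𝓝 (g y))) :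
    Set.EqOn f (poissonIntegral g) (halfSpace m) :=
  eqOn_of_harmonicOnNhd hf
    (harmonicOnNhd_poissonIntegral hg.aestronglyMeasurable (ae_of_all _ hM)) hfM
    (fun _ hz => abs_poissonIntegral_le hm (ae_of_all _ hM) hz) hfg
    (tendsto_poissonIntegral hm hg hM)

end

/-! ### Harmonicity of translates -/

open InnerProductSpace in
lemma harmonicOnNhd_comp_add {f : Euc (m + 1) → ℝ} (hf : HarmonicOnNhd f (halfSpace m)) {s : ℝ}
    (hs : 0 ≤ s) : HarmonicOnNhd (fun z => f (z + pt 0 s)) (halfSpace m) := by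
  have hmem : ∀ z ∈ halfSpace m, z + pt 0 s ∈ halfSpace m := fun z hz => by
    have h1 : 0 < z (Fin.last m) := hz
    simp [halfSpace]
    positivity
  intro z hz
  have hn := isOpen_halfSpace.mem_nhds hz
  refine ⟨ContDiffAt.comp (g := f) z (hf _ (hmem z hz)).1 (contDiffAt_id.add contDiffAt_const), ?_⟩
  filter_upwards [hn] with w hw
  rw [laplacian_eq_sum_fderiv]
  have h1 : fderiv ℝ (fun z => f (z + pt 0 s)) = fun z => fderiv ℝ f (z + pt 0 s) :=
    funext fun z => fderiv_comp_add_right _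
  rw [h1, fderiv_comp_add_right, ← laplacian_eq_sum_fderiv]
  exact (hf _ (hmem w hw)).2.self_of_nhds

/-- A bounded harmonic function on the half-space, pushed down by `s > 0`, is the Poisson integral
of its values at height `s`. -/
lemma comp_add_eq_poissonIntegral (hm : 1 ≤ m) {f : Euc (m + 1) → ℝ}
    (hf : InnerProductSpace.HarmonicOnNhd f (halfSpace m)) {M : ℝ}
    (hM : ∀ z ∈ halfSpace m, |f z| ≤ M) {s : ℝ} (hs : 0 < s) {x : Euc (m + 1)}
    (hx : x ∈ halfSpace m) :
    f (x + pt 0 s) = poissonIntegral (fun y => f (pt y s)) x := by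
  have hmem : ∀ z : Euc (m + 1), 0 ≤ z (Fin.last m) → z + pt 0 s ∈ halfSpace m := fun z hz => by
    simp [halfSpace]
    positivity
  refine eqOn_poissonIntegral (M := M) hm (harmonicOnNhd_comp_add hf hs.le)
    (fun z hz => hM _ (hmem z (le_of_lt hz))) ?_ (fun y => hM _ (pt_mem_halfSpace hs)) ?_ hx
  · exact hf.continuousOn.comp_continuous (continuous_pt_left s) fun y => pt_mem_halfSpace hs
  · intro y
    have h1 : ContinuousAt f (pt y 0 + pt 0 s) :=
      hf.continuousOn.continuousAt (isOpen_halfSpace.mem_nhds (hmem _ (by simp)))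
    have h2 : ContinuousAt (fun z : Euc (m + 1) => f (z + pt 0 s)) (pt y 0) :=
      ContinuousAt.comp (g := f) (f := fun z : Euc (m + 1) => z + pt 0 s) h1 (by fun_prop)
    have h3 : Tendsto (fun z : Euc (m + 1) => f (z + pt 0 s)) (𝓝 (pt y 0))
        (𝓝 (f (pt y 0 + pt 0 s))) := h2
    rw [pt_add_pt, add_zero, zero_add] at h3
    exact h3.mono_left nhdsWithin_le_nhds

/-! ### Weak compactness and the Poisson representation -/

/-- Bounded sequences in a Hilbert space converge weakly along ultrafilters (Banach–Alaoglu). -/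
lemma exists_tendsto_inner_of_bounded {H : Type*} [NormedAddCommGroup H] [InnerProductSpace ℝ H]
    [CompleteSpace H] {ι : Type*} (U : Ultrafilter ι) {a : ι → H} {R : ℝ} (ha : ∀ k, ‖a k‖ ≤ R) :
    ∃ x : H, ∀ z : H, Tendsto (fun k => inner ℝ (a k) z) U (𝓝 (inner ℝ x z)) := by
  set b : ι → WeakDual ℝ H := fun k => StrongDual.toWeakDual (InnerProductSpace.toDual ℝ H (a k))
  have hK := WeakDual.isCompact_closedBall (𝕜 := ℝ) (E := H) 0 R
  obtain ⟨φ, -, hφ⟩ := hK.ultrafilter_le_nhds' (U.map b) <| by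
    rw [Ultrafilter.mem_map]
    refine univ_mem' fun k => ?_
    have h1 : ‖InnerProductSpace.toDual ℝ H (a k)‖ ≤ R := by simpa using ha k
    simpa [b] using h1
  refine ⟨(InnerProductSpace.toDual ℝ H).symm (WeakDual.toStrongDual φ), fun z => ?_⟩
  rw [InnerProductSpace.toDual_symm_apply]
  exact ((WeakDual.eval_continuous z).tendsto φ).comp hφ

lemma abs_setIntegral_le {α : Type*} [MeasurableSpace α] {μ : Measure α} [IsFiniteMeasure μ]
    {f : α → ℝ} {M : ℝ} (hM : ∀ y, |f y| ≤ M) (s : Set α) :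
    |∫ y in s, f y ∂μ| ≤ ∫ _ in s, M ∂μ := by
  rw [← Real.norm_eq_abs]
  exact norm_integral_le_of_norm_le (integrable_const M) (ae_of_all _ hM)

/-- A uniformly bounded family of functions on a finite measure space has, along an ultrafilter, a
weak-* limit satisfying the same bound. -/
lemma exists_weak_limit {α : Type*} [MeasurableSpace α] {μ : Measure α} [IsFiniteMeasure μ]
    {ι : Type*} (U : Ultrafilter ι) {f : ι → α → ℝ} {M : ℝ}
    (hf : ∀ k, AEStronglyMeasurable (f k) μ) (hM : ∀ k y, |f k y| ≤ M) :
    ∃ g : α → ℝ, StronglyMeasurable g ∧ (∀ᵐ y ∂μ, |g y| ≤ M) ∧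
      ∀ (φ : α → ℝ) (C : ℝ), AEStronglyMeasurable φ μ → (∀ y, |φ y| ≤ C) →
        Tendsto (fun k => ∫ y, f k y * φ y ∂μ) U (𝓝 (∫ y, g y * φ y ∂μ)) := by
  have hL : ∀ k, MemLp (f k) 2 μ := fun k => MemLp.of_bound (hf k) M (ae_of_all _ (hM k))
  obtain ⟨G, hG⟩ := exists_tendsto_inner_of_bounded (H := Lp ℝ 2 μ) U
    (a := fun k => (hL k).toLp (f k))
    (R := μ.real Set.univ ^ ((2 : ENNReal).toReal⁻¹) * max M 0) (fun k => by
      refine Lp.norm_le_of_ae_bound (le_max_right _ _) ?_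
      filter_upwards [(hL k).coeFn_toLp] with y hy
      rw [hy]
      exact (hM k y).trans (le_max_left _ _))
  have hlim : ∀ (φ : α → ℝ) (C : ℝ), AEStronglyMeasurable φ μ → (∀ y, |φ y| ≤ C) →
      Tendsto (fun k => ∫ y, f k y * φ y ∂μ) U (𝓝 (∫ y, G y * φ y ∂μ)) := by
    intro φ C hφ hC
    have hφL : MemLp φ 2 μ := MemLp.of_bound hφ C (ae_of_all _ hC)
    have h1 := hG (hφL.toLp φ)
    simp only [L2.inner_def] at h1
    have h2 : ∀ k, ∫ y, inner ℝ ((hL k).toLp (f k) y) (hφL.toLp φ y) ∂μ =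
        ∫ y, f k y * φ y ∂μ := fun k => by
      refine integral_congr_ae ?_
      filter_upwards [(hL k).coeFn_toLp, hφL.coeFn_toLp] with y h3 h4
      rw [h3, h4]
      simp [mul_comm]
    have h3 : ∫ y, inner ℝ (G y) (hφL.toLp φ y) ∂μ = ∫ y, G y * φ y ∂μ := by
      refine integral_congr_ae ?_
      filter_upwards [hφL.coeFn_toLp] with y h4
      rw [h4]
      simp [mul_comm]
    rw [h3] at h1
    exact h1.congr h2
  have hint : Integrable G μ := (Lp.memLp G).integrable (by norm_num)
  refine ⟨G, Lp.stronglyMeasurable G, ?_, hlim⟩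
  have hset : ∀ s, MeasurableSet s →
      Tendsto (fun k => ∫ y in s, f k y ∂μ) U (𝓝 (∫ y in s, G y ∂μ)) := fun s hs => by
    have := hlim (s.indicator 1) 1 (stronglyMeasurable_one.indicator hs).aestronglyMeasurable
      (fun y => by by_cases hy : y ∈ s <;> simp [hy])
    have h1 : ∀ h : α → ℝ, ∫ y, h y * s.indicator 1 y ∂μ = ∫ y in s, h y ∂μ := fun h => by
      rw [← integral_indicator hs]
      refine integral_congr_ae (ae_of_all _ fun y => ?_)
      by_cases hy : y ∈ s <;> simp [hy]
    simpa only [h1] using this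
  -- Testing with indicator functions transfers the bound `M` to the limit.
  have hle : G ≤ᵐ[μ] fun _ => M := by
    refine ae_le_of_forall_setIntegral_le hint (integrable_const M) fun s hs _ => ?_
    exact le_of_tendsto (hset s hs) (Eventually.of_forall fun k =>
      (abs_le.1 (abs_setIntegral_le (hM k) s)).2)
  have hge : (fun _ => -M) ≤ᵐ[μ] G := by
    refine ae_le_of_forall_setIntegral_le (integrable_const (-M)) hint fun s hs _ => ?_
    refine ge_of_tendsto (hset s hs) (Eventually.of_forall fun k => ?_)
    rw [integral_neg]
    exact (abs_le.1 (abs_setIntegral_le (hM k) s)).1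
  filter_upwards [hle, hge] with y h1 h2
  exact abs_le.2 ⟨h2, h1⟩

/-- Lebesgue measure on the boundary weighted by `(1 + |y|)^{-n}`: a finite measure with respect
to which all Poisson kernels have bounded densities. -/
def weightMeasure (m : ℕ) : Measure (Euc m) :=
  volume.withDensity fun y => ((weight y).toNNReal : ENNReal)

lemma integral_weightMeasure (h : Euc m → ℝ) :
    ∫ y, h y ∂(weightMeasure m) = ∫ y, weight y * h y := by
  rw [weightMeasure, integral_withDensity_eq_integral_smul
    (continuous_weight.measurable.real_toNNReal)]
  refine integral_congr_ae (ae_of_all _ fun y => ?_)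
  simp only [NNReal.smul_def, smul_eq_mul]
  rw [Real.coe_toNNReal _ (weight_pos y).le]

instance : IsFiniteMeasure (weightMeasure m) := by
  unfold weightMeasure
  exact isFiniteMeasure_withDensity_ofReal integrable_weight.2

lemma volume_absolutelyContinuous_weightMeasure :
    (volume : Measure (Euc m)) ≪ weightMeasure m := by
  refine withDensity_absolutelyContinuous' ?_ (ae_of_all _ fun y => ?_)
  · exact (continuous_weight.measurable.real_toNNReal.coe_nnreal_ennreal).aemeasurable
  · simpa using weight_pos y

/-- Poisson representation: a bounded harmonic function on the half-space is the Poisson integral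
of a bounded function on the boundary. -/
theorem exists_eq_poissonIntegral (hm : 1 ≤ m) {f : Euc (m + 1) → ℝ}
    (hf : InnerProductSpace.HarmonicOnNhd f (halfSpace m)) {M : ℝ}
    (hM : ∀ z ∈ halfSpace m, |f z| ≤ M) :
    ∃ g : Euc m → ℝ, StronglyMeasurable g ∧ (∀ᵐ y, |g y| ≤ M) ∧
      ∀ x ∈ halfSpace m, f x = poissonIntegral g x := by
  set s : ℕ → ℝ := fun k => 1 / ((k : ℝ) + 1) with hs
  have hs0 : ∀ k, 0 < s k := fun k => by simp only [hs]; positivity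
  have hU : ((hyperfilter ℕ : Ultrafilter ℕ) : Filter ℕ) ≤ atTop := Nat.hyperfilter_le_atTop
  have hmeas : ∀ k, Continuous fun y : Euc m => f (pt y (s k)) := fun k =>
    hf.continuousOn.comp_continuous (continuous_pt_left _) fun y => pt_mem_halfSpace (hs0 k)
  obtain ⟨g, hgm, hgM, hg⟩ := exists_weak_limit (μ := weightMeasure m) (hyperfilter ℕ)
    (f := fun k y => f (pt y (s k))) (M := M)
    (fun k => (hmeas k).aestronglyMeasurable) (fun k y => hM _ (pt_mem_halfSpace (hs0 k)))
  refine ⟨g, hgm, volume_absolutelyContinuous_weightMeasure.ae_le hgM, fun x hx => ?_⟩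
  obtain ⟨δ, hδ, C, -, hC⟩ := slabDecay_poissonKernel.locally_le hx
  -- The Poisson kernel at `x` divided by the weight is a bounded test function.
  have h1 := hg (fun y => poissonKernel (x - pt y 0) / weight y) C
    ((continuous_translate continuousOn_poissonKernel hx).div continuous_weight
      fun y => (weight_pos y).ne').aestronglyMeasurable (fun y => by
      rw [abs_div, abs_of_pos (weight_pos y), div_le_iff₀ (weight_pos y)]
      exact hC x (Metric.mem_ball_self hδ) y)
  have h2 : ∀ h : Euc m → ℝ,
      ∫ y, h y * (poissonKernel (x - pt y 0) / weight y) ∂(weightMeasure m) =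
        poissonIntegral h x := fun h => by
    rw [integral_weightMeasure, poissonIntegral]
    refine integral_congr_ae (ae_of_all _ fun y => ?_)
    have := weight_pos y
    simp only [smul_eq_mul]
    field_simp
  simp only [h2] at h1
  have h3 : Tendsto (fun k => f (x + pt 0 (s k))) atTop (𝓝 (f x)) := by
    have h4 : Tendsto (fun k => x + pt 0 (s k)) atTop (𝓝 x) := by
      have h5 : Tendsto s atTop (𝓝 0) := tendsto_one_div_add_atTop_nhds_zero_nat
      have h6 := ((continuous_pt_right (0 : Euc m)).tendsto 0).comp h5
      have h7 : pt (0 : Euc m) 0 = 0 := by rw [← norm_eq_zero, norm_pt_zero, norm_zero]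
      rw [h7] at h6
      simpa using h6.const_add x
    exact ((hf.continuousOn.continuousAt (isOpen_halfSpace.mem_nhds hx)).tendsto).comp h4
  refine tendsto_nhds_unique (h3.mono_left hU) (h1.congr fun k => ?_)
  exact (comp_add_eq_poissonIntegral hm hf hM (hs0 k) hx).symm

/-! ### Boundary limits at Lebesgue points -/

/-- If a density `d` has mean at most `ε` on all small balls centred at `y₀`, then it has mean at
most `ε` against every radially decreasing function: the superlevel sets of the latter are balls
up to null sets, so the layer cake formula applies. -/
lemma lintegral_mul_radial_le {y₀ : Euc m} {δ : ℝ} {d : Euc m → ENNReal}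
    (hd : Measurable d) {ε : ENNReal}
    (H : ∀ r, 0 < r → r ≤ δ → ∫⁻ y in Metric.closedBall y₀ r, d y ≤
      ε * volume (Metric.closedBall y₀ r))
    (hm : 1 ≤ m) {f : Euc m → ℝ} (hfc : Continuous f) (hf0 : ∀ y, 0 ≤ f y)
    (hf : ∀ y y', dist y y₀ ≤ dist y' y₀ → f y' ≤ f y) :
    ∫⁻ y in Metric.closedBall y₀ δ, d y * ENNReal.ofReal (f y) ≤
      ε * ∫⁻ y in Metric.closedBall y₀ δ, ENNReal.ofReal (f y) := by
  have : Nonempty (Fin m) := ⟨⟨0, hm⟩⟩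
  set μ := (volume : Measure (Euc m)).restrict (Metric.closedBall y₀ δ) with hμ
  have hfm : Measurable fun y => ENNReal.ofReal (f y) := hfc.measurable.ennreal_ofReal
  have h1 : ∫⁻ y, d y * ENNReal.ofReal (f y) ∂μ = ∫⁻ y, ENNReal.ofReal (f y) ∂(μ.withDensity d) :=
    (lintegral_withDensity_eq_lintegral_mul μ hd hfm).symm
  rw [h1, lintegral_eq_lintegral_meas_lt _ (ae_of_all _ hf0) hfc.measurable.aemeasurable,
    lintegral_eq_lintegral_meas_lt _ (ae_of_all _ hf0) hfc.measurable.aemeasurable]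
  have hanti : Antitone fun s : ℝ => μ {y | s < f y} := fun s s' hs =>
    measure_mono fun y hy => lt_of_le_of_lt hs hy
  rw [← lintegral_const_mul ε hanti.measurable]
  refine lintegral_mono fun s => ?_
  have hS : MeasurableSet {y | s < f y} := measurableSet_lt measurable_const hfc.measurable
  rw [withDensity_apply _ hS, hμ, Measure.restrict_restrict hS, Measure.restrict_apply hS]
  set B := {y | s < f y} ∩ Metric.closedBall y₀ δ with hB
  -- `B` contains with a point every point closer to `y₀`, so it lies between the open and the
  -- closed ball of some radius `ρ`, which have the same volume.
  have hlow : ∀ y ∈ B, ∀ y', dist y' y₀ ≤ dist y y₀ → y' ∈ B := fun y hy y' hy' =>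
    ⟨lt_of_lt_of_le hy.1 (hf _ _ hy'), hy'.trans hy.2⟩
  rcases B.eq_empty_or_nonempty with hemp | ⟨y₁, hy₁⟩
  · rw [hemp]
    simp
  have hne : ((fun y => dist y y₀) '' B).Nonempty := ⟨_, y₁, hy₁, rfl⟩
  have hbdd : BddAbove ((fun y => dist y y₀) '' B) := ⟨δ, by
    rintro _ ⟨y, hy, rfl⟩
    exact hy.2⟩
  set ρ := sSup ((fun y => dist y y₀) '' B) with hρ
  have hBρ : B ⊆ Metric.closedBall y₀ ρ := fun y hy => le_csSup hbdd ⟨y, hy, rfl⟩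
  have hρB : Metric.ball y₀ ρ ⊆ B := fun y hy => by
    obtain ⟨_, ⟨y', hy', rfl⟩, hlt⟩ := exists_lt_of_lt_csSup hne (Metric.mem_ball.1 hy)
    exact hlow y' hy' y hlt.le
  have hρδ : ρ ≤ δ := csSup_le hne (by
    rintro _ ⟨y, hy, rfl⟩
    exact hy.2)
  rcases lt_or_ge 0 ρ with hρ0 | hρ0
  · calc ∫⁻ y in B, d y ≤ ∫⁻ y in Metric.closedBall y₀ ρ, d y := lintegral_mono_set hBρ
      _ ≤ ε * volume (Metric.closedBall y₀ ρ) := H ρ hρ0 hρδ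
      _ = ε * volume (Metric.ball y₀ ρ) := by rw [Measure.addHaar_closedBall_eq_addHaar_ball]
      _ ≤ ε * volume B := by gcongr
  · have hnull : volume B = 0 := by
      refine measure_mono_null (hBρ.trans fun y hy => ?_) (measure_singleton y₀)
      exact dist_le_zero.1 (le_trans hy hρ0)
    rw [setLIntegral_measure_zero B d hnull]
    exact zero_le

lemma poissonKernel_pt_le_of_norm_le {y y' : Euc m} (h : ‖y‖ ≤ ‖y'‖) {t : ℝ} (ht : 0 < t) :
    poissonKernel (pt y' t) ≤ poissonKernel (pt y t) := by
  have hc := kernelConst_pos m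
  have hp := norm_pos_iff.2 (ne_zero_of_mem_halfSpace (pt_mem_halfSpace (y := y) ht))
  have h1 : ‖pt y t‖ ≤ ‖pt y' t‖ := by
    rw [norm_pt_eq_sqrt, norm_pt_eq_sqrt]
    gcongr
  rw [poissonKernel_pt, poissonKernel_pt]
  gcongr

/-- Away from the pole the Poisson kernel is of the order of the distance to the boundary. -/
lemma poissonKernel_pt_le_weight {δ : ℝ} (hδ : 0 < δ) {y : Euc m} (hy : δ ≤ ‖y‖) {t : ℝ}
    (ht : 0 < t) :
    poissonKernel (pt y t) ≤ t * (kernelConst m * ((1 + δ) / δ) ^ (m + 1)) * weight y := by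
  have hc := kernelConst_pos m
  have hy0 : 0 < ‖y‖ := hδ.trans_le hy
  have h1 : (1 + ‖y‖) ≤ (1 + δ) / δ * ‖pt y t‖ := by
    refine le_trans ?_ (mul_le_mul_of_nonneg_left (norm_le_norm_pt y t) (by positivity))
    rw [div_mul_eq_mul_div, le_div_iff₀ hδ]
    nlinarith
  have hp : 0 < ‖pt y t‖ := hy0.trans_le (norm_le_norm_pt y t)
  have h2 : (1 + ‖y‖) ^ (m + 1) ≤ ((1 + δ) / δ) ^ (m + 1) * ‖pt y t‖ ^ (m + 1) := by
    rw [← mul_pow]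
    gcongr
  rw [poissonKernel_pt, weight, ← div_eq_mul_inv, mul_div_assoc', div_le_div_iff₀ (by positivity)
    (by positivity)]
  calc kernelConst m * t * (1 + ‖y‖) ^ (m + 1)
      ≤ kernelConst m * t * (((1 + δ) / δ) ^ (m + 1) * ‖pt y t‖ ^ (m + 1)) := by gcongr
    _ = _ := by ring

lemma lintegral_poissonKernel_sub (hm : 1 ≤ m) {x : Euc (m + 1)} (hx : x ∈ halfSpace m) :
    ∫⁻ y : Euc m, ENNReal.ofReal (poissonKernel (x - pt y 0)) = 1 := by
  rw [← ofReal_integral_eq_lintegral_ofReal (integrable_poissonKernel_sub hx)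
    (ae_of_all _ fun y => (poissonKernel_pos (sub_pt_zero_mem hx y)).le),
    integral_poissonKernel_sub hm hx, ENNReal.ofReal_one]

section
variable {g : Euc m → ℝ} {M : ℝ}

lemma enorm_poissonIntegral_sub_le (hm : 1 ≤ m) (hg : AEStronglyMeasurable g volume)
    (hM : ∀ᵐ y, |g y| ≤ M) {x : Euc (m + 1)} (hx : x ∈ halfSpace m) (c : ℝ) :
    ‖poissonIntegral g x - c‖ₑ ≤
      ∫⁻ y, ‖g y - c‖ₑ * ENNReal.ofReal (poissonKernel (x - pt y 0)) := by
  have h1 : poissonIntegral g x - c = ∫ y, (g y - c) * poissonKernel (x - pt y 0) := by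
    have h2 : c = ∫ y, c * poissonKernel (x - pt y 0) := by
      rw [integral_const_mul, integral_poissonKernel_sub hm hx, mul_one]
    have h3 : Integrable fun y => g y • poissonKernel (x - pt y 0) :=
      integrable_translate slabDecay_poissonKernel continuousOn_poissonKernel hg hM hx
    rw [poissonIntegral]
    conv_lhs => rw [h2]
    rw [← integral_sub h3 ((integrable_poissonKernel_sub hx).const_mul c)]
    simp_rw [smul_eq_mul, sub_mul]
  rw [h1]
  refine (enorm_integral_le_lintegral_enorm _).trans_eq ?_
  refine lintegral_congr fun y => ?_
  rw [enorm_mul, Real.enorm_of_nonneg (poissonKernel_pos (sub_pt_zero_mem hx y)).le]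

/-- Fatou's theorem along normals: the Poisson integral of a bounded function converges to it at
almost every boundary point. -/
theorem ae_tendsto_poissonIntegral (hm : 1 ≤ m) (hg : StronglyMeasurable g)
    (hM : ∀ᵐ y, |g y| ≤ M) :
    ∀ᵐ y, Tendsto (fun t : ℝ => poissonIntegral g (pt y t)) (𝓝[>] 0) (𝓝 (g y)) := by
  have hloc : LocallyIntegrable g volume := by
    refine (memLp_top_of_bound hg.aestronglyMeasurable M hM).locallyIntegrable le_top
  filter_upwards [hM, (IsUnifLocDoublingMeasure.vitaliFamily (volume : Measure (Euc m))
    1).ae_tendsto_lintegral_enorm_sub_div hloc] with y₀ hy₀ hleb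
  rw [tendsto_iff_edist_tendsto_0, ENNReal.tendsto_nhds_zero]
  intro ε hε
  have hε2 : 0 < ε / 2 := ENNReal.half_pos hε.ne'
  have hcb : Tendsto (fun r : ℝ => Metric.closedBall y₀ r) (𝓝[>] 0)
      ((IsUnifLocDoublingMeasure.vitaliFamily (volume : Measure (Euc m)) 1).filterAt y₀) :=
    IsUnifLocDoublingMeasure.tendsto_closedBall_filterAt volume (fun _ => y₀) _ tendsto_id
      (eventually_mem_nhdsWithin.mono fun r hr => by
        simpa using le_of_lt (Set.mem_Ioi.1 hr))
  -- Within distance `δ` the averages of `|g - g(y₀)|` are at most `ε / 2`; the rest of the integral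
  -- is `O(t)`.
  obtain ⟨δ, hδ0, hδ⟩ := mem_nhdsGT_iff_exists_Ioc_subset.1
    (ENNReal.tendsto_nhds_zero.1 (hleb.comp hcb) (ε / 2) hε2)
  have hδ0 : 0 < δ := hδ0
  have H : ∀ r, 0 < r → r ≤ δ → ∫⁻ y in Metric.closedBall y₀ r, ‖g y - g y₀‖ₑ ≤
      ε / 2 * volume (Metric.closedBall y₀ r) := fun r hr hrδ => by
    have h1 := hδ ⟨hr, hrδ⟩
    simp only [Set.mem_ofPred_eq, Function.comp_apply] at h1
    refine (ENNReal.div_le_iff ?_ ?_).1 h1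
    · exact (Metric.measure_closedBall_pos _ _ hr).ne'
    · exact measure_closedBall_lt_top.ne
  set A := 2 * M * (kernelConst m * ((1 + δ) / δ) ^ (m + 1)) * ∫ y : Euc m, weight y with hA
  have htail : ∀ᶠ t : ℝ in 𝓝[>] 0, ENNReal.ofReal (t * A) ≤ ε / 2 := by
    have h1 : Tendsto (fun t : ℝ => ENNReal.ofReal (t * A)) (𝓝 0) (𝓝 0) := by
      have : Continuous fun t : ℝ => ENNReal.ofReal (t * A) :=
        ENNReal.continuous_ofReal.comp (by fun_prop)
      simpa using this.tendsto 0
    exact (ENNReal.tendsto_nhds_zero.1 h1 _ hε2).filter_mono nhdsWithin_le_nhds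
  filter_upwards [htail, eventually_mem_nhdsWithin] with t htA ht
  have ht : 0 < t := ht
  have hx : pt y₀ t ∈ halfSpace m := pt_mem_halfSpace ht
  have hpos : ∀ y : Euc m, 0 ≤ poissonKernel (pt y₀ t - pt y 0) := fun y =>
    (poissonKernel_pos (sub_pt_zero_mem hx y)).le
  have hM0 : 0 ≤ M := (abs_nonneg _).trans hy₀
  rw [edist_eq_enorm_sub]
  refine (enorm_poissonIntegral_sub_le hm hg.aestronglyMeasurable hM hx _).trans ?_
  rw [← lintegral_add_compl _ (Metric.isClosed_closedBall (x := y₀) (ε := δ)).measurableSet,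
    ← ENNReal.add_halves ε]
  refine add_le_add ?_ ?_
  · refine (lintegral_mul_radial_le (f := fun y => poissonKernel (pt y₀ t - pt y 0))
      (hg.measurable.sub_const _).enorm H hm (continuous_translate continuousOn_poissonKernel hx)
      hpos ?_).trans ?_
    · intro y y' h
      rw [pt_sub_pt, pt_sub_pt, sub_zero]
      refine poissonKernel_pt_le_of_norm_le ?_ ht
      rwa [← dist_eq_norm, ← dist_eq_norm, dist_comm y₀, dist_comm y₀]
    · calc ε / 2 * ∫⁻ y in Metric.closedBall y₀ δ, ENNReal.ofReal (poissonKernel (pt y₀ t - pt y 0))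
          ≤ ε / 2 * 1 := by
            gcongr
            exact (setLIntegral_le_lintegral _ _).trans_eq (lintegral_poissonKernel_sub hm hx)
        _ = ε / 2 := mul_one _
  · refine le_trans ?_ htA
    set D := kernelConst m * ((1 + δ) / δ) ^ (m + 1) with hD
    have hbound : ∀ᵐ y ∂(volume.restrict (Metric.closedBall y₀ δ)ᶜ),
        ‖g y - g y₀‖ₑ * ENNReal.ofReal (poissonKernel (pt y₀ t - pt y 0)) ≤
          ENNReal.ofReal (2 * M * (t * D * weight (y₀ - y))) := by
      rw [ae_restrict_iff' Metric.isClosed_closedBall.measurableSet.compl]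
      filter_upwards [hM] with y hy hyδ
      rw [← ofReal_norm, ← ENNReal.ofReal_mul (norm_nonneg _)]
      refine ENNReal.ofReal_le_ofReal (mul_le_mul ?_ ?_ (hpos y) (by positivity))
      · rw [Real.norm_eq_abs]
        have := abs_sub (g y) (g y₀)
        linarith
      · rw [pt_sub_pt, sub_zero]
        refine poissonKernel_pt_le_weight hδ0 ?_ ht
        rw [Set.mem_compl_iff, Metric.mem_closedBall, not_le, dist_comm, dist_eq_norm] at hyδ
        exact hyδ.le
    refine (lintegral_mono_ae hbound).trans ((setLIntegral_le_lintegral _ _).trans_eq ?_)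
    have hc := kernelConst_pos m
    rw [← ofReal_integral_eq_lintegral_ofReal]
    · rw [integral_const_mul, integral_const_mul,
        integral_sub_left_eq_self (fun y : Euc m => weight y)]
      congr 1
      rw [hA]
      ring
    · exact ((integrable_weight.comp_sub_left y₀).const_mul _).const_mul _
    · exact ae_of_all _ fun y => by
        have := weight_pos (y₀ - y)
        simp only [Pi.zero_apply]
        positivity

end

/-! ### Bounded harmonic vector fields and their divergence -/

/-- The vector field whose components are the Poisson integrals of the components of `g`. -/
def poissonField (g : Euc m → Euc (m + 1)) (x : Euc (m + 1)) : Euc (m + 1) :=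
  WithLp.toLp 2 fun i => poissonIntegral (fun y => g y i) x

lemma tendsto_euclidean_iff {α : Type*} {l : Filter α} {k : ℕ} {f : α → Euc k} {a : Euc k} :
    Tendsto f l (𝓝 a) ↔ ∀ i, Tendsto (fun b => f b i) l (𝓝 (a i)) := by
  rw [(PiLp.homeomorph 2 fun _ : Fin k => ℝ).isInducing.tendsto_nhds_iff, tendsto_pi_nhds]
  rfl

lemma norm_le_sum_norm {k : ℕ} (v : Euc k) : ‖v‖ ≤ ∑ i, ‖v i‖ := by
  refine (sq_le_sq₀ (norm_nonneg _) (Finset.sum_nonneg fun i _ => norm_nonneg _)).1 ?_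
  rw [EuclideanSpace.norm_sq_eq]
  exact Finset.sum_sq_le_sq_sum_of_nonneg fun i _ => norm_nonneg _

lemma stronglyMeasurable_euclidean {k : ℕ} {g : Euc m → Euc k}
    (hg : ∀ i, StronglyMeasurable fun y => g y i) : StronglyMeasurable g := by
  have h1 : StronglyMeasurable fun y i => g y i :=
    (measurable_pi_lambda _ fun i => (hg i).measurable).stronglyMeasurable
  exact (PiLp.continuous_toLp 2 fun _ : Fin k => ℝ).comp_stronglyMeasurable h1

/-- Every bounded harmonic vector field is, in the half-space, the Poisson integral of an
essentially bounded boundary field, which is its normal limit almost everywhere. -/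
theorem MemHardy.exists_boundary (hm : 1 ≤ m) {u : Euc (m + 1) → Euc (m + 1)} (hu : MemHardy u) :
    ∃ g : Euc m → Euc (m + 1), MemLp g ⊤ volume ∧ HasBoundaryValues u g ∧
      ∀ x ∈ halfSpace m, u x = poissonField g x := by
  obtain ⟨M, hM⟩ := hu.bounded
  have hMi : ∀ i, ∀ z ∈ halfSpace m, |u z i| ≤ M := fun i z hz =>
    (PiLp.norm_apply_le (u z) i).trans (hM z hz)
  choose g hgm hgM hg using fun i => exists_eq_poissonIntegral hm (hu.harmonic i) (hMi i)
  set G : Euc m → Euc (m + 1) := fun y => WithLp.toLp 2 fun i => g i y with hG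
  have hGm : StronglyMeasurable G := stronglyMeasurable_euclidean fun i => hgm i
  have hbv : HasBoundaryValues u G := by
    have h1 : ∀ᵐ y, ∀ i, Tendsto (fun t : ℝ => poissonIntegral (g i) (pt y t)) (𝓝[>] 0)
        (𝓝 (g i y)) := ae_all_iff.2 fun i => ae_tendsto_poissonIntegral hm (hgm i) (hgM i)
    filter_upwards [h1] with y hy
    rw [tendsto_euclidean_iff]
    intro i
    refine (hy i).congr' ?_
    filter_upwards [eventually_mem_nhdsWithin] with t ht
    exact (hg i _ (pt_mem_halfSpace ht)).symm
  refine ⟨G, memLp_top_of_bound hGm.aestronglyMeasurable M ?_, hbv, fun x hx => ?_⟩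
  · filter_upwards [hbv] with y hy
    refine le_of_tendsto hy.norm ?_
    filter_upwards [eventually_mem_nhdsWithin] with t ht
    exact hM _ (pt_mem_halfSpace ht)
  · ext i
    exact hg i x hx

lemma HasBoundaryValues.ae_eq {u : Euc (m + 1) → Euc (m + 1)} {g g' : Euc m → Euc (m + 1)}
    (h : HasBoundaryValues u g) (h' : HasBoundaryValues u g') : g =ᵐ[volume] g' := by
  filter_upwards [h, h'] with y h1 h2
  exact tendsto_nhds_unique h1 h2

lemma divergence_congr {u v : Euc (m + 1) → Euc (m + 1)} (h : ∀ z ∈ halfSpace m, u z = v z)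
    {x : Euc (m + 1)} (hx : x ∈ halfSpace m) : divergence u x = divergence v x := by
  unfold divergence
  refine Finset.sum_congr rfl fun i _ => ?_
  have h1 : (fun z => u z i) =ᶠ[𝓝 x] fun z => v z i := by
    filter_upwards [isOpen_halfSpace.mem_nhds hx] with z hz
    rw [h z hz]
  rw [h1.fderiv_eq]

lemma integrable_kernelGrad {x : Euc (m + 1)} (hx : x ∈ halfSpace m) :
    Integrable fun y : Euc m => ‖kernelGrad (x - pt y 0)‖ := by
  have h1 : ∀ i, Integrable fun y : Euc m => kernelGrad (x - pt y 0) i := fun i => by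
    have := integrable_translate (g := fun _ => (1 : ℝ)) (M := 1) slabDecay_fderiv_poissonKernel
      continuousOn_fderiv_poissonKernel aestronglyMeasurable_const (by simp) hx
    simpa [kernelGrad] using this.apply_continuousLinearMap (EuclideanSpace.single i 1)
  refine Integrable.norm ?_
  refine ⟨?_, ?_⟩
  · exact (continuous_translate (continuousOn_kernelGrad.mono halfSpace_subset_compl)
      hx).aestronglyMeasurable
  · refine HasFiniteIntegral.mono (g := fun y => ∑ i, ‖kernelGrad (x - pt y 0) i‖)
      (integrable_finsetSum _ fun i _ => (h1 i).norm).2 (ae_of_all _ fun y => ?_)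
    rw [Real.norm_of_nonneg (Finset.sum_nonneg fun i _ => norm_nonneg _)]
    exact norm_le_sum_norm _

lemma integral_norm_kernelGrad_sub (hm : 1 ≤ m) {x : Euc (m + 1)} (hx : x ∈ halfSpace m) :
    ∫ y : Euc m, ‖kernelGrad (x - pt y 0)‖ = divConst (m + 1) / x (Fin.last m) := by
  simp_rw [sub_pt_zero_eq]
  rw [integral_sub_left_eq_self fun y : Euc m => ‖kernelGrad (pt y (x (Fin.last m)))‖]
  exact integral_norm_kernelGrad hm hx

/-- The divergence of a Poisson integral, by differentiation under the integral sign. -/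
lemma divergence_poissonField {g : Euc m → Euc (m + 1)} (hg : AEStronglyMeasurable g volume)
    {M : ℝ} (hM : ∀ᵐ y, ‖g y‖ ≤ M) {x : Euc (m + 1)} (hx : x ∈ halfSpace m) :
    divergence (poissonField g) x = ∫ y, inner ℝ (kernelGrad (x - pt y 0)) (g y) := by
  have hgi : ∀ i, AEStronglyMeasurable (fun y => g y i) volume := fun i =>
    (EuclideanSpace.proj (𝕜 := ℝ) i).continuous.comp_aestronglyMeasurable hg
  have hMi : ∀ i, ∀ᵐ y, |g y i| ≤ M := fun i => hM.mono fun y hy =>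
    (PiLp.norm_apply_le (g y) i).trans hy
  have hint : ∀ i, Integrable fun y => g y i • fderiv ℝ poissonKernel (x - pt y 0) := fun i =>
    integrable_translate slabDecay_fderiv_poissonKernel continuousOn_fderiv_poissonKernel
      (hgi i) (hMi i) hx
  have h1 : ∀ i, fderiv ℝ (fun z => poissonField g z i) x (EuclideanSpace.single i 1) =
      ∫ y, g y i * kernelGrad (x - pt y 0) i := fun i => by
    have h2 : (fun z => poissonField g z i) = poissonIntegral fun y => g y i := rfl
    rw [h2, (hasFDerivAt_poissonIntegral (hgi i) (hMi i) hx).fderiv,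
      ContinuousLinearMap.integral_apply (hint i)]
    rfl
  unfold divergence
  simp_rw [h1]
  rw [← integral_finsetSum _ fun i _ => ?_]
  · refine integral_congr_ae (ae_of_all _ fun y => ?_)
    simp [PiLp.inner_apply]
  · exact (hint i).apply_continuousLinearMap (EuclideanSpace.single i 1)

lemma memHardy_poissonField (hm : 1 ≤ m) {g : Euc m → Euc (m + 1)}
    (hg : AEStronglyMeasurable g volume) {M : ℝ} (hM : ∀ᵐ y, ‖g y‖ ≤ M) :
    MemHardy (poissonField g) := by
  have hgi : ∀ i, AEStronglyMeasurable (fun y => g y i) volume := fun i =>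
    (EuclideanSpace.proj (𝕜 := ℝ) i).continuous.comp_aestronglyMeasurable hg
  have hMi : ∀ i, ∀ᵐ y, |g y i| ≤ M := fun i => hM.mono fun y hy =>
    (PiLp.norm_apply_le (g y) i).trans hy
  refine ⟨fun i => harmonicOnNhd_poissonIntegral (hgi i) (hMi i), ∑ _i : Fin (m + 1), M,
    fun z hz => ?_⟩
  calc ‖poissonField g z‖ ≤ ∑ i, |poissonField g z i| := norm_le_sum_norm _
    _ ≤ ∑ _i : Fin (m + 1), M := Finset.sum_le_sum fun i _ =>
        abs_poissonIntegral_le hm (hMi i) hz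

/-- The boundary field that is extremal for the divergence at `x`: at each boundary point, the
direction of the gradient of the Poisson kernel at `x`. -/
def extremalBoundary (x : Euc (m + 1)) (y : Euc m) : Euc (m + 1) :=
  ‖kernelGrad (x - pt y 0)‖⁻¹ • kernelGrad (x - pt y 0)

lemma norm_extremalBoundary (hm : 1 ≤ m) {x : Euc (m + 1)} (hx : x ∈ halfSpace m) (y : Euc m) :
    ‖extremalBoundary x y‖ = 1 := by
  have h := kernelGrad_ne_zero hm (ne_zero_of_mem_halfSpace (sub_pt_zero_mem hx y))
  rw [extremalBoundary, norm_smul, norm_inv, norm_norm, inv_mul_cancel₀ (norm_ne_zero_iff.2 h)]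

lemma continuous_extremalBoundary (hm : 1 ≤ m) {x : Euc (m + 1)} (hx : x ∈ halfSpace m) :
    Continuous (extremalBoundary (m := m) x) := by
  have h := continuous_translate (continuousOn_kernelGrad.mono halfSpace_subset_compl) hx
  exact (h.norm.inv₀ fun y => norm_ne_zero_iff.2
    (kernelGrad_ne_zero hm (ne_zero_of_mem_halfSpace (sub_pt_zero_mem hx y)))).smul h

lemma inner_extremalBoundary (hm : 1 ≤ m) {x : Euc (m + 1)} (hx : x ∈ halfSpace m) (y : Euc m) :
    inner ℝ (kernelGrad (x - pt y 0)) (extremalBoundary x y) = ‖kernelGrad (x - pt y 0)‖ := by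
  have h := norm_ne_zero_iff.2
    (kernelGrad_ne_zero hm (ne_zero_of_mem_halfSpace (sub_pt_zero_mem hx y)))
  rw [extremalBoundary, inner_smul_right, real_inner_self_eq_norm_sq]
  field_simp

lemma hasBoundaryValues_poissonField (hm : 1 ≤ m) {g : Euc m → Euc (m + 1)} (hg : Continuous g)
    {M : ℝ} (hM : ∀ y, ‖g y‖ ≤ M) : HasBoundaryValues (poissonField g) g := by
  refine ae_of_all _ fun y => ?_
  rw [tendsto_euclidean_iff]
  intro i
  have h1 : Tendsto (poissonIntegral fun y => g y i) (𝓝[halfSpace m] (pt y 0)) (𝓝 (g y i)) :=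
    tendsto_poissonIntegral (M := M) hm (by fun_prop)
      (fun y => (PiLp.norm_apply_le (g y) i).trans (hM y)) y
  refine h1.comp (tendsto_nhdsWithin_iff.2 ⟨?_, ?_⟩)
  · exact ((continuous_pt_right y).tendsto 0).mono_left nhdsWithin_le_nhds
  · exact eventually_mem_nhdsWithin.mono fun t ht => pt_mem_halfSpace ht

lemma abs_divergence_le (hm : 1 ≤ m) {u : Euc (m + 1) → Euc (m + 1)} {g : Euc m → Euc (m + 1)}
    (hu : MemHardy u) (hg : HasBoundaryValues u g) {x : Euc (m + 1)} (hx : x ∈ halfSpace m) :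
    |divergence u x| ≤ divConst (m + 1) / x (Fin.last m) * (eLpNorm g ⊤ volume).toReal := by
  obtain ⟨g', hg', hbv, hu'⟩ := hu.exists_boundary hm
  rw [eLpNorm_congr_ae (hg.ae_eq hbv)]
  set N := (eLpNorm g' ⊤ volume).toReal with hN
  have hle : ∀ᵐ y, ‖g' y‖ ≤ N := by
    filter_upwards [ae_le_eLpNormEssSup (f := g') (μ := volume)] with y hy
    have h1 : ‖g' y‖ₑ ≤ eLpNorm g' ⊤ volume := by rwa [eLpNorm_exponent_top]
    have h2 := ENNReal.toReal_mono hg'.2.ne h1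
    rwa [toReal_enorm] at h2
  rw [divergence_congr hu' hx, divergence_poissonField hg'.1 hle hx,
    ← integral_norm_kernelGrad_sub hm hx, ← integral_mul_const, ← Real.norm_eq_abs]
  refine norm_integral_le_of_norm_le ((integrable_kernelGrad hx).mul_const N) ?_
  filter_upwards [hle] with y hy
  exact (norm_inner_le_norm (𝕜 := ℝ) _ _).trans (mul_le_mul_of_nonneg_left hy (norm_nonneg _))

lemma divConst_div_le (hm : 1 ≤ m) {x : Euc (m + 1)} (hx : x ∈ halfSpace m) {C : ℝ}
    (hC : ∀ (u : Euc (m + 1) → Euc (m + 1)) (g : Euc m → Euc (m + 1)), MemHardy u →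
      HasBoundaryValues u g → |divergence u x| ≤ C * (eLpNorm g ⊤ volume).toReal) :
    divConst (m + 1) / x (Fin.last m) ≤ C := by
  set g := extremalBoundary (m := m) x with hg
  have hgc : Continuous g := continuous_extremalBoundary hm hx
  have hg1 : ∀ y, ‖g y‖ = 1 := norm_extremalBoundary hm hx
  have hgm : AEStronglyMeasurable g volume := hgc.aestronglyMeasurable
  have hle : ∀ᵐ y, ‖g y‖ ≤ 1 := ae_of_all _ fun y => (hg1 y).le
  have h1 := hC _ g (memHardy_poissonField hm hgm hle)
    (hasBoundaryValues_poissonField hm hgc fun y => (hg1 y).le)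
  have h2 : eLpNorm g ⊤ volume = 1 := by
    have h3 : eLpNorm g ⊤ volume = eLpNorm (fun _ : Euc m => (1 : ℝ)) ⊤ volume :=
      eLpNorm_congr_norm_ae (ae_of_all _ fun y => by simp [hg1 y])
    rw [h3, eLpNorm_const _ ENNReal.top_ne_zero (NeZero.ne _)]
    simp
  rw [h2, divergence_poissonField hgm hle hx] at h1
  simp_rw [hg, inner_extremalBoundary hm hx] at h1
  rw [integral_norm_kernelGrad_sub hm hx, ENNReal.toReal_one, mul_one] at h1
  exact (le_abs_self _).trans h1

end HalfSpaceDiv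

end

theorem proposition4 :
    (∀ m : ℕ, 1 ≤ m →
      -- every field of the Hardy space has boundary values, which are essentially bounded
      (∀ u : EuclideanSpace ℝ (Fin (m + 1)) → EuclideanSpace ℝ (Fin (m + 1)),
        HalfSpaceDiv.MemHardy u →
          ∃ g : EuclideanSpace ℝ (Fin m) → EuclideanSpace ℝ (Fin (m + 1)),
            MemLp g ⊤ volume ∧ HalfSpaceDiv.HasBoundaryValues u g) ∧
      -- the sharp coefficient at every point of the half-space
      ∀ x ∈ HalfSpaceDiv.halfSpace m,
        IsLeast
          {C : ℝ |
            ∀ (u : EuclideanSpace ℝ (Fin (m + 1)) → EuclideanSpace ℝ (Fin (m + 1)))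
              (g : EuclideanSpace ℝ (Fin m) → EuclideanSpace ℝ (Fin (m + 1))),
              HalfSpaceDiv.MemHardy u → HalfSpaceDiv.HasBoundaryValues u g →
                |HalfSpaceDiv.divergence u x| ≤ C * (eLpNorm g ⊤ volume).toReal}
          (HalfSpaceDiv.divConst (m + 1) / x (Fin.last m))) ∧
    HalfSpaceDiv.divConst 2 = 1 ∧
    HalfSpaceDiv.divConst 3 = 1 + Real.sqrt 3 / 6 * Real.log (2 + Real.sqrt 3) := by
  refine ⟨fun m hm => ⟨fun u hu => ?_, fun x hx => ⟨fun u g hu hg => ?_, fun C hC => ?_⟩⟩,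
    HalfSpaceDiv.divConst_two, HalfSpaceDiv.divConst_three⟩
  · obtain ⟨g, hg, hbv, -⟩ := hu.exists_boundary hm
    exact ⟨g, hg, hbv⟩
  · exact HalfSpaceDiv.abs_divergence_le hm hu hg hx
  · exact HalfSpaceDiv.divConst_div_le hm hx hC
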